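/- Let $\eta$ be the metric of a metric space $\mathcal X$ with Borel $\sigma$-algebra $\mathcal F$ and an origin $\mathbf 0\in\mathcal X$, and write $\|\mu-\nu\|=\sup_{A\in\mathcal F}|\mu(A)-\nu(A)|$ for probability measures. Consider the following setup. $P$ is a Markov kernel on $\mathcal X$ that is Harris ergodic with stationary probability distribution $\pi$ (irreducible, Harris recurrent and aperiodic, with $\pi P=\pi$), so that $\lim_{n}\|P^n(x,\cdot)-\pi\|=0$ for all $x\in\mathcal X$; there is $D<\infty$ with $P(x,\{y:\eta(x,y)\le D\})=1$ for all $x$; $K\in\mathcal F$ is bounded and nonempty, $x_0\in K$, and $K_D$ is the set of states within distance $D$ of $K$. An adversarial Markov chain is a process $\{X_n\}_{n\ge 0}$ in $\mathcal X$ with $X_0=x_0$ such that $\mathbf P(X_{n+1}\in A\mid X_0,\dots,X_n)=P(X_n,A)$ whenever $X_n\notin K$ ($n\ge 0$, $A\in\mathcal F$), and such that $X_{n+1}\in K_D$ almost surely whenever $X_n\in K$ (otherwise it may move arbitrarily from $K$). It is bounded in probability if $\lim_{L\to\infty}\sup_{n}\mathbf P(\eta(X_n,\mathbf 0)>L)=0$.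 There exist a countable subset $\mathcal X$ of $\mathbf R^2$ (with the Euclidean metric), an instance of this setup on $\mathcal X$, and an adversarial Markov chain $\{X_n\}$ for it that is not bounded in probability. This is possible even under the strong continuity condition that $\mathcal X$ is closed and $$\forall x\in\mathcal X,\ \forall\epsilon>0,\ \exists\delta>0:\quad \|P(y,\cdot)-P(x,\cdot)\|<\epsilon\ \text{ whenever } \eta(x,y)<\delta .$$ Moreover, under this same condition, the example can be chosen such that $P$ is irreducible and positive recurrent on the countable set $\mathcal X$, while $\{X_n\}$ is a time-homogeneous Markov chain whose transition kernel $Q$ equals $P$ outside $K$, never moves more than a distance $D$, and is irreducible and null recurrent. -/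

import Mathlib

open MeasureTheory ProbabilityTheory Filter Topology
open scoped ENNReal

noncomputable section

namespace AdversarialMarkov

/-! ### Markov chains on a measurable space -/

section Chains

variable {𝓧 : Type*} [MeasurableSpace 𝓧]

/-- Total variation distance `sup_A |μ(A) - ν(A)|` over measurable sets `A`. -/
def tvDist (μ ν : Measure 𝓧) : ℝ :=
  ⨆ A : {A : Set 𝓧 // MeasurableSet A}, |μ.real A.1 - ν.real A.1|

/-- The law on path space of the time-homogeneous Markov chain with transition kernel `κ`
started at `x` (at each time `n` the next state is drawn from `κ` at the current state `h n`). -/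
def chainLaw (κ : Kernel 𝓧 𝓧) [IsMarkovKernel κ] (x : 𝓧) : Measure (ℕ → 𝓧) :=
  Kernel.traj (X := fun _ => 𝓧)
    (fun n => κ.comap (fun h : (i : Finset.Iic n) → 𝓧 => h ⟨n, Finset.mem_Iic.2 le_rfl⟩)
      (measurable_pi_apply _)) 0 (fun _ => x)

/-- `P` is Harris ergodic with stationary probability distribution `ν`: it is irreducible, Harris
recurrent and aperiodic, with invariant probability measure `ν`, and `P ^ n` converges to `ν` in
total variation from every initial state. -/
structure HarrisErgodic (P : Kernel 𝓧 𝓧) [IsMarkovKernel P] (ν : Measure 𝓧) : Prop where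
  prob : IsProbabilityMeasure ν
  invariant : P.Invariant ν
  irreducible : P.IsIrreducible ν
  harris : ∀ A : Set 𝓧, MeasurableSet A → 0 < ν A →
    ∀ x, ∀ᵐ ω ∂(chainLaw P x), ∃ᶠ n in atTop, ω n ∈ A
  aperiodic : ∀ d : ℕ, 2 ≤ d → ¬ ∃ E : ZMod d → Set 𝓧,
    (∀ i, MeasurableSet (E i)) ∧ Pairwise (fun i j => Disjoint (E i) (E j)) ∧
    (∀ i, ∀ x ∈ E i, P x (E (i + 1)) = 1) ∧ 0 < ν (E 0)
  tendsto : ∀ x, Tendsto (fun n : ℕ => tvDist ((P ^ n) x) ν) atTop (𝓝 0)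

/-- The first time `n ≥ 1` at which the path `ω` visits `x` (`∞` if there is none). -/
def returnTime (x : 𝓧) (ω : ℕ → 𝓧) : ℝ≥0∞ :=
  ⨅ (n : ℕ) (_ : 1 ≤ n ∧ ω n = x), (n : ℝ≥0∞)

/-- Every state can be reached from every state (for chains on a countable space). -/
def IsIrreducibleChain (κ : Kernel 𝓧 𝓧) : Prop :=
  ∀ x y, ∃ n : ℕ, 0 < (κ ^ n) x {y}

/-- An irreducible chain on a countable space, all of whose states have finite mean return time. -/
def IsPositiveRecurrent (κ : Kernel 𝓧 𝓧) [IsMarkovKernel κ] : Prop :=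
  IsIrreducibleChain κ ∧ ∀ x, ∫⁻ ω, returnTime x ω ∂(chainLaw κ x) < ∞

/-- An irreducible chain on a countable space, to each of whose states the chain almost surely
returns, with infinite mean return time. -/
def IsNullRecurrent (κ : Kernel 𝓧 𝓧) [IsMarkovKernel κ] : Prop :=
  IsIrreducibleChain κ ∧
    ∀ x, (∀ᵐ ω ∂(chainLaw κ x), returnTime x ω < ∞) ∧
      ∫⁻ ω, returnTime x ω ∂(chainLaw κ x) = ∞

variable {Ω : Type*} [MeasurableSpace Ω]

/-- The σ-algebra generated by `X 0, …, X n`. -/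
abbrev history (X : ℕ → Ω → 𝓧) (n : ℕ) : MeasurableSpace Ω :=
  ⨆ i ∈ Finset.Iic n, MeasurableSpace.comap (X i) inferInstance

/-- `X` is a time-homogeneous Markov chain with transition kernel `κ`:
`ℙ(X (n+1) ∈ A | X 0, …, X n) = κ (X n, A)` almost surely. -/
def IsMarkovChain (κ : Kernel 𝓧 𝓧) (μ : Measure Ω) (X : ℕ → Ω → 𝓧) : Prop :=
  ∀ (n : ℕ) (A : Set 𝓧), MeasurableSet A →
    ∀ᵐ ω ∂μ, (μ⟦X (n + 1) ⁻¹' A | history X n⟧) ω = (κ (X n ω)).real A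

end Chains

/-! ### Adversarial Markov chains on a metric space -/

section Adversarial

variable {𝓧 : Type*} [MetricSpace 𝓧] [MeasurableSpace 𝓧] [BorelSpace 𝓧]

/-- Continuity of `x ↦ P(x, ·)` in total variation. -/
def TVContinuous (P : Kernel 𝓧 𝓧) : Prop :=
  ∀ x, ∀ ε > 0, ∃ δ > 0, ∀ y, dist x y < δ → tvDist (P y) (P x) < ε

/-- `neighbourhood K r` is the set `K_r` of all states within distance `r` of `K`. -/
def neighbourhood (K : Set 𝓧) (r : ℝ) : Set 𝓧 := {y | ∃ x ∈ K, dist x y ≤ r}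

variable (𝓧) in
/-- The ingredients of an adversarial Markov chain: an origin, a Harris ergodic kernel `P` with
jumps bounded by `D`, a bounded nonempty Borel set `K` and an initial state in `K`. -/
structure AdversarialSetup where
  origin : 𝓧
  P : Kernel 𝓧 𝓧
  markov : IsMarkovKernel P
  statDist : Measure 𝓧
  ergodic : HarrisErgodic P statDist
  D : ℝ
  bounded_jumps : ∀ x, P x {y | dist x y ≤ D} = 1
  K : Set 𝓧
  K_measurable : MeasurableSet K
  K_bounded : Bornology.IsBounded K
  K_nonempty : K.Nonempty
  x₀ : 𝓧
  x₀_mem : x₀ ∈ K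

attribute [instance] AdversarialSetup.markov

variable {Ω : Type*} [MeasurableSpace Ω]

/-- `X` is an adversarial process: it starts at `x₀`, follows `P` (given its whole history)
whenever it is outside `K`, and from `K` it may move arbitrarily, but only to points of `K_D`. -/
structure AdversarialSetup.IsAdversarialChain (S : AdversarialSetup 𝓧)
    (μ : Measure Ω) (X : ℕ → Ω → 𝓧) : Prop where
  prob : IsProbabilityMeasure μ
  measurable : ∀ n, Measurable (X n)
  initial : ∀ᵐ ω ∂μ, X 0 ω = S.x₀
  follows : ∀ (n : ℕ) (A : Set 𝓧), MeasurableSet A →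
    ∀ᵐ ω ∂μ, X n ω ∉ S.K →
      (μ⟦X (n + 1) ⁻¹' A | history X n⟧) ω = (S.P (X n ω)).real A
  adversary : ∀ n : ℕ, ∀ᵐ ω ∂μ, X n ω ∈ S.K → X (n + 1) ω ∈ neighbourhood S.K S.D

/-- Boundedness in probability: `lim_{L → ∞} sup_n ℙ(η(X n, 0) > L) = 0`. -/
def AdversarialSetup.BoundedInProbability (S : AdversarialSetup 𝓧)
    (μ : Measure Ω) (X : ℕ → Ω → 𝓧) : Prop :=
  Tendsto (fun L : ℝ => ⨆ n : ℕ, μ {ω | L < dist (X n ω) S.origin}) atTop (𝓝 0)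

end Adversarial

end AdversarialMarkov

end

/-!
The state space has a base and, for each `a`, a tower of points of heights `1, 2, …`. Started in the
tower `a`, the walk climbs until it leaves the tower, then descends deterministically in the tower
`0`, at the limit of the other towers, back to the base. Climbing from a fixed height becomes
unlikely as `a` grows, so the kernel is continuous in total variation at the tower `0`, whereas the
mean duration of an excursion into the tower `a` is at least `4 ^ a`. The two walks differ only in
the probabilities with which the base launches an excursion into each tower: those of the tame walk
make the mean return time finite, those of the wild walk make it infinite.

For the tame walk, the occupation measure of an excursion is an invariant law, and two independent
copies meet at the base, so it is ergodic. For the wild walk, the infinite mean return time makes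
the number of visits to the base before time `N` of order `o(N)`, while an excursion spends a
bounded mean time below any given height: the walk is above that height most of the time.
-/

noncomputable section

namespace AdversarialMarkov

/-! ### Powers of kernels and return times -/

section Powers

variable {X : Type*} [MeasurableSpace X] {κ : Kernel X X}

lemma kernel_one_apply (x : X) : (1 : Kernel X X) x = Measure.dirac x := Kernel.id_apply x

lemma lintegral_pow_succ (κ : Kernel X X) (n : ℕ) (x : X) {f : X → ℝ≥0∞} (hf : Measurable f) :
    ∫⁻ z, f z ∂(κ ^ (n + 1)) x = ∫⁻ w, ∫⁻ z, f z ∂κ w ∂(κ ^ n) x := by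
  rw [pow_succ']
  exact Kernel.lintegral_comp _ _ _ hf

lemma lintegral_pow_succ' (κ : Kernel X X) (n : ℕ) (x : X) {f : X → ℝ≥0∞} (hf : Measurable f) :
    ∫⁻ z, f z ∂(κ ^ (n + 1)) x = ∫⁻ w, ∫⁻ z, f z ∂(κ ^ n) w ∂κ x := by
  rw [pow_succ]
  exact Kernel.lintegral_comp _ _ _ hf

instance isMarkovKernel_pow (κ : Kernel X X) [IsMarkovKernel κ] (n : ℕ) :
    IsMarkovKernel (κ ^ n) := by
  induction n with
  | zero => rw [pow_zero]; exact inferInstanceAs (IsMarkovKernel Kernel.id)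
  | succ n ih => rw [pow_succ]; exact inferInstanceAs (IsMarkovKernel (_ ∘ₖ _))

lemma lintegral_singleton_mul_le (μ : Measure X) [MeasurableSingletonClass X] (f : X → ℝ≥0∞)
    (y : X) : f y * μ {y} ≤ ∫⁻ z, f z ∂μ := by
  rw [← lintegral_singleton]
  exact setLIntegral_le_lintegral _ _

lemma pow_mul_pow_le [MeasurableSingletonClass X] (κ : Kernel X X) (m n : ℕ) (x y z : X) :
    (κ ^ m) x {y} * (κ ^ n) y {z} ≤ (κ ^ (m + n)) x {z} := by
  rw [Kernel.pow_add_apply_eq_lintegral _ _ _ _ (measurableSet_singleton z), mul_comm]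
  exact lintegral_singleton_mul_le _ (fun b => (κ ^ n) b {z}) y

lemma pow_pos_trans [MeasurableSingletonClass X] {m n : ℕ} {x y z : X} (hxy : 0 < (κ ^ m) x {y})
    (hyz : 0 < (κ ^ n) y {z}) : 0 < (κ ^ (m + n)) x {z} :=
  (ENNReal.mul_pos hxy.ne' hyz.ne').trans_le (pow_mul_pow_le κ m n x y z)

lemma exists_pow_pos_of_reflTransGen [MeasurableSingletonClass X] {x y : X}
    (h : Relation.ReflTransGen (fun x y => 0 < κ x {y}) x y) : ∃ n : ℕ, 0 < (κ ^ n) x {y} := by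
  induction h with
  | refl => exact ⟨0, by simp [kernel_one_apply]⟩
  | tail _ hyz ih =>
    obtain ⟨n, hn⟩ := ih
    exact ⟨n + 1, pow_pos_trans hn (by simpa using hyz)⟩

lemma pow_self_pos [MeasurableSingletonClass X] {x : X} (hx : 0 < κ x {x}) (n : ℕ) :
    0 < (κ ^ n) x {x} := by
  induction n with
  | zero => simp [kernel_one_apply]
  | succ n ih => exact pow_pos_trans ih (by simpa using hx)

theorem sum_lintegral_pow_add_le {a b V : X → ℝ≥0∞} (ha : Measurable a)
    (hV : Measurable V) (h : ∀ z, a z + ∫⁻ w, V w ∂κ z ≤ V z + b z) (N : ℕ) (z : X) :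
    ∑ n ∈ Finset.range N, ∫⁻ w, a w ∂(κ ^ n) z + ∫⁻ w, V w ∂(κ ^ N) z ≤
      V z + ∑ n ∈ Finset.range N, ∫⁻ w, b w ∂(κ ^ n) z := by
  induction N with
  | zero => simp [kernel_one_apply, lintegral_dirac' _ hV]
  | succ N ih =>
    have step : ∫⁻ w, a w ∂(κ ^ N) z + ∫⁻ w, V w ∂(κ ^ (N + 1)) z ≤
        ∫⁻ w, V w ∂(κ ^ N) z + ∫⁻ w, b w ∂(κ ^ N) z := by
      rw [lintegral_pow_succ κ N z hV, ← lintegral_add_left ha, ← lintegral_add_left hV]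
      exact lintegral_mono h
    rw [Finset.sum_range_succ, Finset.sum_range_succ, add_assoc, ← add_assoc (V z)]
    calc _ ≤ _ := add_le_add_right step _
      _ ≤ _ := by rw [← add_assoc]; exact add_le_add_left ih _

theorem add_sum_lintegral_pow_le {a b V : X → ℝ≥0∞} (ha : Measurable a)
    (hV : Measurable V) (h : ∀ z, V z + b z ≤ a z + ∫⁻ w, V w ∂κ z) (N : ℕ) (z : X) :
    V z + ∑ n ∈ Finset.range N, ∫⁻ w, b w ∂(κ ^ n) z ≤
      ∑ n ∈ Finset.range N, ∫⁻ w, a w ∂(κ ^ n) z + ∫⁻ w, V w ∂(κ ^ N) z := by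
  induction N with
  | zero => simp [kernel_one_apply, lintegral_dirac' _ hV]
  | succ N ih =>
    have step : ∫⁻ w, V w ∂(κ ^ N) z + ∫⁻ w, b w ∂(κ ^ N) z ≤
        ∫⁻ w, a w ∂(κ ^ N) z + ∫⁻ w, V w ∂(κ ^ (N + 1)) z := by
      rw [lintegral_pow_succ κ N z hV, ← lintegral_add_left ha, ← lintegral_add_left hV]
      exact lintegral_mono h
    rw [Finset.sum_range_succ, Finset.sum_range_succ, add_assoc, ← add_assoc (V z)]
    calc _ ≤ _ := add_le_add_left ih _
      _ ≤ _ := by rw [add_assoc]; exact add_le_add_right step _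

end Powers

section Green

variable {X : Type*} [MeasurableSpace X] {κ : Kernel X X}

/-- The Green kernel `∑ₙ κⁿ`: the expected time spent in a set. It is used for substochastic `κ`,
namely for a chain stopped at its first return to a point. -/
def greenKernel (κ : Kernel X X) : Kernel X X := Kernel.sum fun n => κ ^ n

lemma lintegral_greenKernel (κ : Kernel X X) (f : X → ℝ≥0∞) (z : X) :
    ∫⁻ w, f w ∂greenKernel κ z = ∑' n, ∫⁻ w, f w ∂(κ ^ n) z := by
  rw [greenKernel, Kernel.sum_apply, lintegral_sum_measure]

lemma lintegral_greenKernel_eq_add_lintegral (κ : Kernel X X) {f : X → ℝ≥0∞} (hf : Measurable f)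
    (z : X) :
    ∫⁻ w, f w ∂greenKernel κ z = f z + ∫⁻ w, ∫⁻ v, f v ∂greenKernel κ w ∂κ z := by
  simp_rw [lintegral_greenKernel]
  rw [tsum_eq_zero_add' ENNReal.summable, pow_zero, kernel_one_apply, lintegral_dirac' _ hf,
    lintegral_tsum fun n => (hf.lintegral_kernel (κ := κ ^ n)).aemeasurable]
  simp_rw [lintegral_pow_succ' κ _ z hf]

lemma add_lintegral_lintegral_greenKernel (κ : Kernel X X) {f : X → ℝ≥0∞} (hf : Measurable f)
    (z : X) :
    f z + ∫⁻ w, ∫⁻ v, f v ∂κ w ∂greenKernel κ z = ∫⁻ w, f w ∂greenKernel κ z := by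
  simp_rw [lintegral_greenKernel, ← lintegral_pow_succ κ _ z hf]
  rw [tsum_eq_zero_add' (f := fun n => ∫⁻ w, f w ∂(κ ^ n) z) ENNReal.summable, pow_zero,
    kernel_one_apply, lintegral_dirac' _ hf]

theorem lintegral_greenKernel_le {f V : X → ℝ≥0∞} (hf : Measurable f) (hV : Measurable V)
    (h : ∀ z, f z + ∫⁻ w, V w ∂κ z ≤ V z) (z : X) : ∫⁻ w, f w ∂greenKernel κ z ≤ V z := by
  rw [lintegral_greenKernel]
  refine ENNReal.tsum_le_of_sum_range_le fun N => ?_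
  simpa using le_self_add.trans
    (sum_lintegral_pow_add_le (b := 0) hf hV (fun z => (h z).trans le_self_add) N z)

end Green

section Taboo

variable {X : Type*} [MeasurableSpace X] [MeasurableSingletonClass X] {κ : Kernel X X}

/-- The taboo kernel of `y`: the transitions of `κ` that do not lead to `y`. -/
def taboo (κ : Kernel X X) (y : X) : Kernel X X := κ.restrict (measurableSet_singleton y).compl

/-- The probability that the chain started at `z` does not visit `y` at the times `1, …, k`. -/
def survival (κ : Kernel X X) (y : X) (k : ℕ) (z : X) : ℝ≥0∞ := (taboo κ y ^ k) z Set.univ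

/-- The probability that the chain started at `z` does not visit `y` at any time `n ≥ 1`. -/
def escapeProb (κ : Kernel X X) (y z : X) : ℝ≥0∞ := ⨅ k, survival κ y k z

/-- The expectation, for the chain started at `z`, of the first time `n ≥ 1` at which it is at `y`.
It is written as a mass of the Green kernel of the taboo kernel because the latter also provides
the invariant measure. -/
def meanReturnTime (κ : Kernel X X) (y z : X) : ℝ≥0∞ := greenKernel (taboo κ y) z Set.univ

instance isFiniteKernel_taboo (κ : Kernel X X) [IsFiniteKernel κ] (y : X) :
    IsFiniteKernel (taboo κ y) := by
  unfold taboo; infer_instance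

lemma lintegral_taboo_add_mul (κ : Kernel X X) (y z : X) (f : X → ℝ≥0∞) :
    ∫⁻ w, f w ∂taboo κ y z + f y * κ z {y} = ∫⁻ w, f w ∂κ z := by
  rw [taboo, Kernel.restrict_apply, ← lintegral_singleton, add_comm,
    lintegral_add_compl _ (measurableSet_singleton y)]

lemma taboo_apply_univ_add [IsMarkovKernel κ] (y z : X) :
    taboo κ y z Set.univ + κ z {y} = 1 := by
  simpa using lintegral_taboo_add_mul κ y z 1

lemma taboo_le (κ : Kernel X X) (y z : X) : taboo κ y z ≤ κ z := by
  rw [taboo, Kernel.restrict_apply]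
  exact Measure.restrict_le_self

lemma taboo_apply_self (κ : Kernel X X) (y z : X) : taboo κ y z {y} = 0 := by
  simp [taboo, Kernel.restrict_apply]

lemma taboo_apply_univ_le_one [IsMarkovKernel κ] (y z : X) : taboo κ y z Set.univ ≤ 1 :=
  le_self_add.trans (taboo_apply_univ_add y z).le

lemma taboo_pow_le (κ : Kernel X X) (y : X) (n : ℕ) (z : X) : (taboo κ y ^ n) z ≤ (κ ^ n) z := by
  refine Measure.le_iff.2 fun s hs => ?_
  induction n generalizing z with
  | zero => simp
  | succ n ih =>
    rw [Nat.add_comm n, Kernel.pow_add_apply_eq_lintegral _ _ _ _ hs,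
      Kernel.pow_add_apply_eq_lintegral _ _ _ _ hs, pow_one, pow_one]
    exact lintegral_mono' (taboo_le κ y z) ih

lemma measurable_survival (κ : Kernel X X) (y : X) (k : ℕ) : Measurable (survival κ y k) :=
  Kernel.measurable_coe _ .univ

lemma survival_zero (κ : Kernel X X) (y z : X) : survival κ y 0 z = 1 := by
  simp [survival, kernel_one_apply]

lemma survival_add (κ : Kernel X X) (y : X) (m k : ℕ) (z : X) :
    survival κ y (m + k) z = ∫⁻ w, survival κ y k w ∂(taboo κ y ^ m) z :=
  Kernel.pow_add_apply_eq_lintegral _ m k z .univ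

lemma survival_succ (κ : Kernel X X) (y : X) (k : ℕ) (z : X) :
    survival κ y (k + 1) z = ∫⁻ w, survival κ y k w ∂taboo κ y z := by
  rw [add_comm, survival_add, pow_one]

lemma survival_antitone [IsMarkovKernel κ] (y : X) : Antitone (survival κ y) := by
  refine antitone_nat_of_succ_le fun k z => ?_
  calc survival κ y (k + 1) z = ∫⁻ w, taboo κ y w Set.univ ∂(taboo κ y ^ k) z :=
        Kernel.pow_succ_apply_eq_lintegral _ _ _ .univ
    _ ≤ ∫⁻ _, 1 ∂(taboo κ y ^ k) z := lintegral_mono (taboo_apply_univ_le_one y)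
    _ = survival κ y k z := lintegral_one

lemma survival_le_one [IsMarkovKernel κ] (y : X) (k : ℕ) (z : X) : survival κ y k z ≤ 1 :=
  (survival_antitone y k.zero_le z).trans_eq (survival_zero κ y z)

lemma survival_succ_add_pow_le [IsMarkovKernel κ] (y : X) (n : ℕ) (z : X) :
    survival κ y (n + 1) z + (κ ^ (n + 1)) z {y} ≤ 1 := by
  have avoid : (taboo κ y ^ (n + 1)) z {y} = 0 := by
    rw [Kernel.pow_succ_apply_eq_lintegral _ _ _ (measurableSet_singleton y)]
    simp [taboo_apply_self]
  calc survival κ y (n + 1) z + (κ ^ (n + 1)) z {y}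
      = (taboo κ y ^ (n + 1)) z {y}ᶜ + (κ ^ (n + 1)) z {y} := by
        rw [survival, ← measure_add_measure_compl (measurableSet_singleton y), avoid, zero_add]
    _ ≤ (κ ^ (n + 1)) z {y}ᶜ + (κ ^ (n + 1)) z {y} := add_le_add_left (taboo_pow_le κ y _ z _) _
    _ = 1 := by
        rw [add_comm, measure_add_measure_compl (measurableSet_singleton y), measure_univ]

lemma measurable_escapeProb (κ : Kernel X X) (y : X) : Measurable (escapeProb κ y) :=
  Measurable.iInf (measurable_survival κ y)

lemma escapeProb_le_one [IsMarkovKernel κ] (y z : X) : escapeProb κ y z ≤ 1 :=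
  iInf_le_of_le 0 (survival_le_one y 0 z)

lemma tendsto_survival [IsMarkovKernel κ] (y z : X) :
    Tendsto (fun k => survival κ y k z) atTop (𝓝 (escapeProb κ y z)) :=
  tendsto_atTop_iInf fun _ _ h => survival_antitone y h z

lemma tendsto_lintegral_survival [IsMarkovKernel κ] (y : X) (μ : Measure X) [IsFiniteMeasure μ] :
    Tendsto (fun k => ∫⁻ z, survival κ y k z ∂μ) atTop (𝓝 (∫⁻ z, escapeProb κ y z ∂μ)) :=
  tendsto_lintegral_of_dominated_convergence 1 (measurable_survival κ y)
    (fun k => .of_forall (survival_le_one y k)) (by simp) (.of_forall (tendsto_survival y))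

lemma lintegral_taboo_escapeProb [IsMarkovKernel κ] (y z : X) :
    ∫⁻ w, escapeProb κ y w ∂taboo κ y z = escapeProb κ y z := by
  refine tendsto_nhds_unique (tendsto_lintegral_survival y (taboo κ y z)) ?_
  simp_rw [← survival_succ]
  exact (tendsto_survival y z).comp (tendsto_add_atTop_nat 1)

lemma escapeProb_eq_lintegral_taboo_pow [IsMarkovKernel κ] (y z : X) (n : ℕ) :
    escapeProb κ y z = ∫⁻ w, escapeProb κ y w ∂(taboo κ y ^ n) z := by
  induction n with
  | zero => simp [kernel_one_apply, lintegral_dirac' _ (measurable_escapeProb κ y)]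
  | succ n ih =>
    rw [lintegral_pow_succ _ _ _ (measurable_escapeProb κ y), ih]
    simp_rw [lintegral_taboo_escapeProb]

lemma lintegral_escapeProb [IsMarkovKernel κ] (y z : X) :
    ∫⁻ w, escapeProb κ y w ∂κ z = escapeProb κ y z + escapeProb κ y y * κ z {y} := by
  rw [← lintegral_taboo_add_mul κ y z, lintegral_taboo_escapeProb]

lemma meanReturnTime_eq_tsum (κ : Kernel X X) (y z : X) :
    meanReturnTime κ y z = ∑' k, survival κ y k z := by
  simpa [meanReturnTime, survival] using lintegral_greenKernel (taboo κ y) 1 z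

lemma meanReturnTime_eq_one_add (κ : Kernel X X) (y z : X) :
    meanReturnTime κ y z = 1 + ∫⁻ w, meanReturnTime κ y w ∂taboo κ y z := by
  simpa [meanReturnTime] using lintegral_greenKernel_eq_add_lintegral (taboo κ y) measurable_one z

lemma one_add_mul_meanReturnTime_le (κ : Kernel X X) {y w : X} (hw : w ≠ y) (z : X) :
    1 + κ z {w} * meanReturnTime κ y w ≤ meanReturnTime κ y z := by
  have hset : taboo κ y z {w} = κ z {w} := by
    rw [taboo, Kernel.restrict_apply' _ _ _ (measurableSet_singleton w),
      Set.inter_eq_left.2 (by simpa using hw.symm)]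
  rw [meanReturnTime_eq_one_add κ y z, mul_comm, ← hset]
  exact add_le_add_right (lintegral_singleton_mul_le _ _ w) 1

lemma add_lintegral_taboo_le {y : X} {f V : X → ℝ≥0∞}
    (h : ∀ z, z ≠ y → f z + ∫⁻ w, V w ∂κ z ≤ V z) (z : X) :
    f z + ∫⁻ w, (f w + ∫⁻ v, V v ∂κ w) ∂taboo κ y z ≤ f z + ∫⁻ w, V w ∂κ z := by
  refine add_le_add_right ?_ _
  calc ∫⁻ w, (f w + ∫⁻ v, V v ∂κ w) ∂taboo κ y z ≤ ∫⁻ w, V w ∂taboo κ y z := by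
        rw [taboo, Kernel.restrict_apply]
        exact setLIntegral_mono' (measurableSet_singleton y).compl fun w hw => h w hw
    _ ≤ ∫⁻ w, V w ∂κ z := lintegral_mono' (taboo_le κ y z) le_rfl

theorem meanReturnTime_le {y : X} {V : X → ℝ≥0∞} (hV : Measurable V)
    (h : ∀ z, z ≠ y → 1 + ∫⁻ w, V w ∂κ z ≤ V z) (z : X) :
    meanReturnTime κ y z ≤ 1 + ∫⁻ w, V w ∂κ z := by
  simpa [meanReturnTime] using lintegral_greenKernel_le measurable_one
    (measurable_const.add hV.lintegral_kernel) (add_lintegral_taboo_le (f := 1) h) z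

lemma escapeProb_eq_zero_of_meanReturnTime_ne_top [IsMarkovKernel κ] {y z : X}
    (h : meanReturnTime κ y z ≠ ∞) : escapeProb κ y z = 0 :=
  tendsto_nhds_unique (tendsto_survival y z)
    (ENNReal.tendsto_atTop_zero_of_tsum_ne_top (meanReturnTime_eq_tsum κ y z ▸ h))

end Taboo

section Recurrence

variable {X : Type*} [MeasurableSpace X] [MeasurableSingletonClass X] {κ : Kernel X X}
  [IsMarkovKernel κ]

lemma escapeProb_self_eq_zero {y : X} (h : ∀ z, z ≠ y → escapeProb κ y z = 0) :
    escapeProb κ y y = 0 := by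
  rw [← lintegral_taboo_escapeProb, taboo, Kernel.restrict_apply]
  exact setLIntegral_eq_zero (measurableSet_singleton y).compl fun z hz => h z hz

lemma escapeProb_eq_zero_of_reachable {y z : X} (hy : escapeProb κ y y = 0)
    (hyz : ∃ n : ℕ, 0 < (κ ^ n) y {z}) : escapeProb κ y z = 0 := by
  have mean_pow (n : ℕ) : ∫⁻ w, escapeProb κ y w ∂(κ ^ n) y = 0 := by
    induction n with
    | zero => simpa [kernel_one_apply, lintegral_dirac' _ (measurable_escapeProb κ y)] using hy
    | succ n ih =>
      rw [lintegral_pow_succ _ _ _ (measurable_escapeProb κ y)]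
      simp_rw [lintegral_escapeProb, hy, zero_mul, add_zero, ih]
  obtain ⟨n, hn⟩ := hyz
  have : escapeProb κ y z * (κ ^ n) y {z} ≤ 0 :=
    (lintegral_singleton_mul_le _ _ z).trans_eq (mean_pow n)
  simpa [hn.ne'] using this

lemma le_survival_add {g : X → ℝ≥0∞} (g_le_one : ∀ z, g z ≤ 1)
    (hg : ∀ z, g z ≤ ∫⁻ w, g w ∂κ z) (o : X) (n : ℕ) (z : X) : g z ≤ survival κ o n z + g o := by
  induction n generalizing z with
  | zero => exact (g_le_one z).trans ((survival_zero κ o z).ge.trans le_self_add)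
  | succ n ih =>
    calc g z ≤ ∫⁻ w, g w ∂taboo κ o z + g o * κ z {o} :=
          (hg z).trans_eq (lintegral_taboo_add_mul κ o z g).symm
      _ ≤ ∫⁻ w, (survival κ o n w + g o) ∂taboo κ o z + g o * κ z {o} := by gcongr; exact ih _
      _ = survival κ o (n + 1) z + g o * (taboo κ o z Set.univ + κ z {o}) := by
          rw [lintegral_add_left (measurable_survival κ o n), lintegral_const, ← survival_succ,
            mul_add, add_assoc]
      _ = survival κ o (n + 1) z + g o := by rw [taboo_apply_univ_add, mul_one]

lemma le_of_escapeProb_eq_zero {g : X → ℝ≥0∞} (g_le_one : ∀ z, g z ≤ 1)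
    (hg : ∀ z, g z ≤ ∫⁻ w, g w ∂κ z) {o z : X} (ho : escapeProb κ o z = 0) : g z ≤ g o := by
  have lim := (tendsto_survival (κ := κ) o z).add_const (g o)
  rw [ho, zero_add] at lim
  exact ge_of_tendsto' lim fun n => le_survival_add g_le_one hg o n z

theorem escapeProb_eq_zero_of_recurrent {o x : X} (ho : ∀ z, escapeProb κ o z = 0)
    (hox : ∃ n : ℕ, 0 < (κ ^ n) o {x}) (z : X) : escapeProb κ x z = 0 := by
  obtain ⟨n, hn⟩ := hox
  rcases n with _ | n
  · have : o = x := by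
      by_contra hne
      simp [kernel_one_apply, hne] at hn
    exact this ▸ ho z
  have max_at_o (z : X) : escapeProb κ x z ≤ escapeProb κ x o :=
    le_of_escapeProb_eq_zero (escapeProb_le_one x)
      (fun z => (lintegral_escapeProb x z).ge.trans' le_self_add) (ho z)
  have contraction : escapeProb κ x o ≤ escapeProb κ x o * survival κ x (n + 1) o := by
    nth_rw 1 [escapeProb_eq_lintegral_taboo_pow x o (n + 1)]
    exact (lintegral_mono max_at_o).trans_eq (lintegral_const _)
  have lt_one : survival κ x (n + 1) o < 1 := by
    refine lt_of_lt_of_le (ENNReal.lt_add_right ?_ hn.ne') (survival_succ_add_pow_le x n o)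
    exact ((survival_le_one x _ o).trans_lt ENNReal.one_lt_top).ne
  have finite : escapeProb κ x o ≠ ∞ := ((escapeProb_le_one x o).trans_lt ENNReal.one_lt_top).ne
  have vanish : escapeProb κ x o = 0 := by
    by_contra h
    exact (ENNReal.mul_lt_mul_right h finite lt_one).not_ge (by rwa [mul_one])
  exact le_antisymm ((max_at_o z).trans_eq vanish) zero_le

end Recurrence

/-! ### The law on path space -/

section Paths

variable {X : Type*} [MeasurableSpace X] {κ : Kernel X X} [IsMarkovKernel κ]

instance isProbabilityMeasure_chainLaw (κ : Kernel X X) [IsMarkovKernel κ] (x : X) :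
    IsProbabilityMeasure (chainLaw κ x) := by
  unfold chainLaw; infer_instance

lemma chainLaw_map_zero (κ : Kernel X X) [IsMarkovKernel κ] (x : X) :
    (chainLaw κ x).map (fun ω => ω 0) = Measure.dirac x := by
  have h : (fun ω : ℕ → X => ω 0) = (fun h : (i : Finset.Iic 0) → X => h ⟨0, by simp⟩) ∘
      (Preorder.frestrictLe (π := fun _ => X) 0) := rfl
  rw [h, ← Measure.map_map (by fun_prop) (by fun_prop), chainLaw,
    Kernel.traj_map_frestrictLe_apply, Kernel.partialTraj_self, Kernel.id_apply,
    Measure.map_dirac' (by fun_prop)]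

lemma lintegral_chainLaw_succ (κ : Kernel X X) [IsMarkovKernel κ] (x : X) (n : ℕ)
    {F : ((i : Finset.Iic n) → X) → X → ℝ≥0∞} (hF : Measurable (Function.uncurry F)) :
    ∫⁻ ω, F (Preorder.frestrictLe (π := fun _ => X) n ω) (ω (n + 1)) ∂chainLaw κ x =
      ∫⁻ ω, ∫⁻ y, F (Preorder.frestrictLe (π := fun _ => X) n ω) y ∂κ (ω n) ∂chainLaw κ x := by
  unfold chainLaw
  set T : (n : ℕ) → Kernel ((i : Finset.Iic n) → X) X := fun n =>
    κ.comap (fun h : (i : Finset.Iic n) → X => h ⟨n, Finset.mem_Iic.2 le_rfl⟩)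
      (measurable_pi_apply _)
  have pair_law := Kernel.partialTraj_compProd_eq_map_traj (X := fun _ => X) (κ := T)
    (Nat.zero_le n) (x₀ := fun _ => x)
  calc _ = ∫⁻ p, Function.uncurry F p ∂((Kernel.traj (X := fun _ => X) T 0 (fun _ => x)).map
          (fun ω => (Preorder.frestrictLe (π := fun _ => X) n ω, ω (n + 1)))) := by
        rw [lintegral_map hF (by fun_prop)]; rfl
    _ = _ := by
        rw [← pair_law, Measure.lintegral_compProd hF, ← Kernel.traj_map_frestrictLe_apply,
          lintegral_map hF.lintegral_kernel_prod_right' (by fun_prop)]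
        rfl

lemma setLIntegral_chainLaw_succ (κ : Kernel X X) [IsMarkovKernel κ] (x : X) (n : ℕ)
    {B : Set ((i : Finset.Iic n) → X)} (hB : MeasurableSet B) {f : X → ℝ≥0∞} (hf : Measurable f) :
    ∫⁻ ω in Preorder.frestrictLe (π := fun _ => X) n ⁻¹' B, f (ω (n + 1)) ∂chainLaw κ x =
      ∫⁻ ω in Preorder.frestrictLe (π := fun _ => X) n ⁻¹' B, ∫⁻ w, f w ∂κ (ω n) ∂chainLaw κ x := by
  have hm := (Preorder.measurable_frestrictLe (X := fun _ : ℕ => X) n) hB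
  rw [← lintegral_indicator hm, ← lintegral_indicator hm]
  refine Eq.trans ?_ ((lintegral_chainLaw_succ κ x n (F := fun h w => B.indicator (fun _ => f w) h)
    ?_).trans ?_)
  · rfl
  · exact (hf.comp measurable_snd).indicator (measurable_fst hB)
  · refine lintegral_congr fun ω => ?_
    by_cases h : Preorder.frestrictLe (π := fun _ => X) n ω ∈ B <;> simp [h]

lemma lintegral_chainLaw_eval (κ : Kernel X X) [IsMarkovKernel κ] (x : X) (n : ℕ)
    {f : X → ℝ≥0∞} (hf : Measurable f) :
    ∫⁻ ω, f (ω n) ∂chainLaw κ x = ∫⁻ z, f z ∂(κ ^ n) x := by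
  induction n generalizing f with
  | zero =>
    rw [pow_zero, kernel_one_apply, ← chainLaw_map_zero κ x, lintegral_map hf (by fun_prop)]
  | succ n ih =>
    have markov := setLIntegral_chainLaw_succ κ x n MeasurableSet.univ hf
    simp only [Set.preimage_univ, Measure.restrict_univ] at markov
    rw [markov, ih hf.lintegral_kernel, lintegral_pow_succ κ n x hf]

lemma chainLaw_map_eval (κ : Kernel X X) [IsMarkovKernel κ] (x : X) (n : ℕ) :
    (chainLaw κ x).map (fun ω => ω n) = (κ ^ n) x :=
  Measure.ext_of_lintegral _ fun f hf => by
    rw [lintegral_map hf (measurable_pi_apply n), lintegral_chainLaw_eval κ x n hf]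

theorem isMarkovChain_chainLaw (κ : Kernel X X) [IsMarkovKernel κ] (x : X) :
    IsMarkovChain κ (chainLaw κ x) (fun n ω => ω n) := by
  intro n A hA
  have history_eq : history (fun n (ω : ℕ → X) => ω n) n =
      Filtration.piLE (X := fun _ => X) n := by
    rw [Filtration.piLE_eq_comap_frestrictLe]
    simp only [history, MeasurableSpace.pi, MeasurableSpace.comap_iSup, MeasurableSpace.comap_comp]
    rw [iSup_subtype']
    rfl
  rw [history_eq]
  have hm : MeasurableSet ((fun ω : ℕ → X => ω (n + 1)) ⁻¹' A) := hA.preimage (by fun_prop)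
  have condExp := Kernel.condExp_traj (X := fun _ => X) (κ := fun n =>
      κ.comap (fun h : (i : Finset.Iic n) → X => h ⟨n, Finset.mem_Iic.2 le_rfl⟩)
        (measurable_pi_apply _)) (Nat.zero_le n) (x₀ := fun _ => x)
    (f := ((fun ω : ℕ → X => ω (n + 1)) ⁻¹' A).indicator (fun _ => (1 : ℝ)))
    ((integrable_const _).indicator hm)
  filter_upwards [condExp] with ω hω
  unfold chainLaw
  rw [hω, integral_indicator_const _ hm, smul_eq_mul, mul_one, measureReal_def, measureReal_def,
    ← Measure.map_apply (by fun_prop) hA, ← Kernel.map_apply _ (by fun_prop),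
    Kernel.map_traj_succ_self]
  rfl

lemma ae_chainLaw_succ (x : X) (n : ℕ) {R : X → X → Prop}
    (hR : MeasurableSet {p : X × X | R p.1 p.2}) (h : ∀ z, ∀ᵐ w ∂κ z, R z w) :
    ∀ᵐ ω ∂chainLaw κ x, R (ω n) (ω (n + 1)) := by
  have hind : Measurable ({p : X × X | R p.1 p.2}ᶜ.indicator (1 : X × X → ℝ≥0∞)) :=
    measurable_one.indicator hR.compl
  have markov := lintegral_chainLaw_succ κ x n
    (F := fun h w => {p : X × X | R p.1 p.2}ᶜ.indicator 1 (h ⟨n, Finset.mem_Iic.2 le_rfl⟩, w))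
    (hind.comp (by fun_prop))
  have step_zero (z : X) : ∫⁻ w, {p : X × X | R p.1 p.2}ᶜ.indicator 1 (z, w) ∂κ z = 0 :=
    lintegral_eq_zero_of_ae_eq_zero ((h z).mono fun w hw => by simp [hw])
  simp only [Preorder.frestrictLe_apply, step_zero, lintegral_zero] at markov
  filter_upwards [(lintegral_eq_zero_iff (hind.comp (by fun_prop))).1 markov] with ω hω
  simpa using hω

end Paths

section Visits

/-- The set of paths that do not visit `y` at the times `n + 1, …, n + k`. -/
def avoiding {X : Type*} (y : X) (n k : ℕ) : Set (ℕ → X) := {ω | ∀ i ∈ Set.Ioc n (n + k), ω i ≠ y}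

lemma avoiding_zero {X : Type*} (y : X) (n : ℕ) : avoiding y n 0 = Set.univ := by
  simp [avoiding]

lemma avoiding_succ {X : Type*} (y : X) (n k : ℕ) :
    avoiding y n (k + 1) = (fun ω => ω (n + k + 1)) ⁻¹' {y}ᶜ ∩ avoiding y n k := by
  ext ω
  constructor
  · exact fun h => ⟨h _ ⟨by omega, by omega⟩, fun i hi => h i ⟨hi.1, by have := hi.2; omega⟩⟩
  · rintro ⟨last, before⟩ i ⟨hi, hi'⟩
    rcases hi'.eq_or_lt with rfl | hlt
    · exact last
    · exact before i ⟨hi, by omega⟩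

lemma returnTime_eq_tsum {X : Type*} (y : X) (ω : ℕ → X) :
    returnTime y ω = ∑' k, (avoiding y 0 k).indicator 1 ω := by
  classical
  by_cases h : ∃ n, 1 ≤ n ∧ ω n = y
  · have mem_iff (k : ℕ) : ω ∈ avoiding y 0 k ↔ k ∈ Finset.range (Nat.find h) := by
      rw [Finset.mem_range, Nat.lt_find_iff]
      exact ⟨fun hk m hm hit => hk m ⟨hit.1, by omega⟩ hit.2,
        fun hk i hi hit => hk i (by have := hi.2; omega) ⟨hi.1, hit⟩⟩
    calc returnTime y ω = (Nat.find h : ℝ≥0∞) :=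
          le_antisymm (iInf₂_le (Nat.find h) (Nat.find_spec h))
            (le_iInf₂ fun n hn => by exact_mod_cast Nat.find_min' h hn)
      _ = ∑' k, (avoiding y 0 k).indicator 1 ω := by
          rw [tsum_eq_sum (s := Finset.range (Nat.find h)) fun k hk => Set.indicator_of_notMem
              (mt (mem_iff k).1 hk) _, Finset.sum_congr rfl fun k hk => Set.indicator_of_mem
              ((mem_iff k).2 hk) _]
          simp
  · push Not at h
    have mem (k : ℕ) : ω ∈ avoiding y 0 k := fun i hi => h i hi.1
    have infinite : returnTime y ω = ∞ :=
      top_unique (le_iInf₂ fun n hn => absurd hn.2 (h n hn.1))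
    simp [infinite, mem]

variable {X : Type*} [MeasurableSpace X] [MeasurableSingletonClass X] {κ : Kernel X X}
  [IsMarkovKernel κ]

lemma exists_avoiding_eq_preimage (y : X) (n k : ℕ) :
    ∃ B, MeasurableSet B ∧
      avoiding y n k = Preorder.frestrictLe (π := fun _ => X) (n + k) ⁻¹' B := by
  refine ⟨⋂ i : Finset.Iic (n + k), {h | n < i.1 → h i ∈ ({y}ᶜ : Set X)}, .iInter fun i => ?_, ?_⟩
  · exact (MeasurableSet.const _).imp
      ((measurableSet_singleton y).compl.preimage (measurable_pi_apply i))
  · ext ω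
    simp only [avoiding, Set.mem_Ioc, Set.mem_ofPred_eq, Set.preimage_iInter, Set.mem_iInter]
    exact ⟨fun h i hi => h i ⟨hi, Finset.mem_Iic.1 i.2⟩,
      fun h i hi => h ⟨i, Finset.mem_Iic.2 hi.2⟩ hi.1⟩

lemma measurableSet_avoiding (y : X) (n k : ℕ) : MeasurableSet (avoiding y n k) := by
  obtain ⟨B, hB, h⟩ := exists_avoiding_eq_preimage y n k
  exact h ▸ Preorder.measurable_frestrictLe _ hB

lemma setLIntegral_avoiding (κ : Kernel X X) [IsMarkovKernel κ] (x y : X) (n k : ℕ)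
    {f : X → ℝ≥0∞} (hf : Measurable f) :
    ∫⁻ ω in avoiding y n k, f (ω (n + k)) ∂chainLaw κ x =
      ∫⁻ z, ∫⁻ w, f w ∂(taboo κ y ^ k) z ∂(κ ^ n) x := by
  induction k generalizing f with
  | zero =>
    simp [avoiding_zero, kernel_one_apply, lintegral_dirac' _ hf, lintegral_chainLaw_eval κ x n hf]
  | succ k ih =>
    have hy : MeasurableSet ({y}ᶜ : Set X) := (measurableSet_singleton y).compl
    obtain ⟨B, hB, hpre⟩ := exists_avoiding_eq_preimage y n k
    calc ∫⁻ ω in avoiding y n (k + 1), f (ω (n + k + 1)) ∂chainLaw κ x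
        = ∫⁻ ω in avoiding y n k, ({y}ᶜ : Set X).indicator f (ω (n + k + 1)) ∂chainLaw κ x := by
          rw [avoiding_succ, ← setLIntegral_indicator (hy.preimage (measurable_pi_apply _))]
          rfl
      _ = ∫⁻ ω in avoiding y n k, ∫⁻ w, f w ∂taboo κ y (ω (n + k)) ∂chainLaw κ x := by
          rw [hpre, setLIntegral_chainLaw_succ κ x _ hB (hf.indicator hy)]
          simp_rw [lintegral_indicator hy, taboo, Kernel.restrict_apply]
      _ = ∫⁻ z, ∫⁻ w, f w ∂(taboo κ y ^ (k + 1)) z ∂(κ ^ n) x := by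
          rw [ih hf.lintegral_kernel]
          simp_rw [lintegral_pow_succ _ _ _ hf]

lemma chainLaw_avoiding (κ : Kernel X X) [IsMarkovKernel κ] (x y : X) (n k : ℕ) :
    chainLaw κ x (avoiding y n k) = ∫⁻ z, survival κ y k z ∂(κ ^ n) x := by
  simpa [survival] using setLIntegral_avoiding κ x y n k measurable_one

theorem lintegral_returnTime (κ : Kernel X X) [IsMarkovKernel κ] (x y : X) :
    ∫⁻ ω, returnTime y ω ∂chainLaw κ x = meanReturnTime κ y x := by
  simp_rw [returnTime_eq_tsum, meanReturnTime_eq_tsum]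
  rw [lintegral_tsum fun k =>
    (measurable_one.indicator (measurableSet_avoiding y 0 k)).aemeasurable]
  refine tsum_congr fun k => ?_
  rw [lintegral_indicator_one (measurableSet_avoiding y 0 k), chainLaw_avoiding, pow_zero,
    kernel_one_apply, lintegral_dirac' _ (measurable_survival κ y k)]

lemma chainLaw_never_le (x y : X) (n : ℕ) :
    chainLaw κ x {ω | ¬ ∃ i > n, ω i = y} ≤ ∫⁻ z, escapeProb κ y z ∂(κ ^ n) x := by
  refine ge_of_tendsto' (tendsto_lintegral_survival y ((κ ^ n) x)) fun k => ?_
  rw [← chainLaw_avoiding]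
  exact measure_mono fun ω hω i hi hit => hω ⟨i, hi.1, hit⟩

lemma ae_exists_visit {y : X} (h : ∀ z, escapeProb κ y z = 0) (x : X) (n : ℕ) :
    ∀ᵐ ω ∂chainLaw κ x, ∃ i > n, ω i = y :=
  ae_iff.2 (le_antisymm ((chainLaw_never_le x y n).trans_eq (by simp [h])) zero_le)

lemma ae_frequently_visit {y : X} (h : ∀ z, escapeProb κ y z = 0) (x : X) :
    ∀ᵐ ω ∂chainLaw κ x, ∃ᶠ n in atTop, ω n = y := by
  filter_upwards [ae_all_iff.2 (ae_exists_visit h x)] with ω hω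
  exact Nat.frequently_atTop_iff_infinite.2 (Set.infinite_of_forall_exists_gt fun n =>
    (hω n).imp fun _ hi => ⟨hi.2, hi.1⟩)

lemma ae_returnTime_lt_top {y : X} (h : ∀ z, escapeProb κ y z = 0) (x : X) :
    ∀ᵐ ω ∂chainLaw κ x, returnTime y ω < ∞ := by
  filter_upwards [ae_exists_visit h x 0] with ω ⟨i, hi, hit⟩
  exact (iInf₂_le i ⟨hi, hit⟩).trans_lt (ENNReal.natCast_lt_top i)

end Visits

/-! ### Invariant laws and convergence in total variation -/

section Invariant

variable {X : Type*} [MeasurableSpace X] {κ : Kernel X X} {ν : Measure X}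

lemma lintegral_of_invariant (hν : κ.Invariant ν) {f : X → ℝ≥0∞} (hf : Measurable f) :
    ∫⁻ z, ∫⁻ w, f w ∂κ z ∂ν = ∫⁻ z, f z ∂ν := by
  rw [← Measure.lintegral_bind κ.aemeasurable hf.aemeasurable, hν.def]

lemma invariant_pow (hν : κ.Invariant ν) (n : ℕ) : (κ ^ n).Invariant ν := by
  induction n with
  | zero => exact Measure.id_comp
  | succ n ih => rw [pow_succ]; exact ih.comp hν

lemma lintegral_pow_apply_of_invariant (hν : κ.Invariant ν) (n : ℕ) {s : Set X}
    (hs : MeasurableSet s) : ∫⁻ z, (κ ^ n) z s ∂ν = ν s := by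
  simpa [lintegral_indicator_one hs] using
    lintegral_of_invariant (invariant_pow hν n) (measurable_one.indicator hs)

variable [MeasurableSingletonClass X]

/-- The expectation of the minimum of `M` and the first time `n ≥ 1` at which the chain started
at `z` is at `y`. -/
def truncatedReturnTime (κ : Kernel X X) (y : X) (M : ℕ) (z : X) : ℝ≥0∞ :=
  ∑ k ∈ Finset.range M, survival κ y k z

lemma measurable_truncatedReturnTime (κ : Kernel X X) (y : X) (M : ℕ) :
    Measurable (truncatedReturnTime κ y M) :=
  Finset.measurable_fun_sum _ fun k _ => measurable_survival κ y k

lemma truncatedReturnTime_le [IsMarkovKernel κ] (y : X) (M : ℕ) (z : X) :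
    truncatedReturnTime κ y M z ≤ M := by
  simpa [truncatedReturnTime] using
    Finset.sum_le_card_nsmul (Finset.range M) _ 1 fun k _ => survival_le_one y k z

lemma truncatedReturnTime_add_mul_le (y : X) (M : ℕ) (z : X) :
    truncatedReturnTime κ y M z + truncatedReturnTime κ y M y * κ z {y} ≤
      1 + ∫⁻ w, truncatedReturnTime κ y M w ∂κ z := by
  have poisson : truncatedReturnTime κ y M z ≤
      1 + ∫⁻ w, truncatedReturnTime κ y M w ∂taboo κ y z := by
    calc truncatedReturnTime κ y M z ≤ truncatedReturnTime κ y (M + 1) z :=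
          Finset.sum_le_sum_of_subset (Finset.range_subset_range.2 M.le_succ)
      _ = 1 + ∫⁻ w, truncatedReturnTime κ y M w ∂taboo κ y z := by
          simp_rw [truncatedReturnTime]
          rw [Finset.sum_range_succ', survival_zero, add_comm,
            lintegral_finsetSum _ fun k _ => measurable_survival κ y k]
          simp_rw [survival_succ]
  rw [← lintegral_taboo_add_mul κ y z, ← add_assoc]
  exact add_le_add_left poisson _

theorem meanReturnTime_mul_le_one [IsMarkovKernel κ] [IsProbabilityMeasure ν]
    (hν : κ.Invariant ν) (y : X) : meanReturnTime κ y y * ν {y} ≤ 1 := by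
  rw [meanReturnTime_eq_tsum, ← ENNReal.tsum_mul_right]
  refine ENNReal.tsum_le_of_sum_range_le fun M => ?_
  rw [← Finset.sum_mul]
  set T := truncatedReturnTime κ y M
  have hT : Measurable T := measurable_truncatedReturnTime κ y M
  have finite : ∫⁻ z, T z ∂ν ≠ ∞ := by
    refine ne_top_of_le_ne_top (ENNReal.natCast_ne_top M) ?_
    simpa using lintegral_mono (μ := ν) (truncatedReturnTime_le (κ := κ) y M)
  refine (ENNReal.add_le_add_iff_left finite).1 ?_
  calc ∫⁻ z, T z ∂ν + T y * ν {y} = ∫⁻ z, (T z + T y * κ z {y}) ∂ν := by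
        have := lintegral_pow_apply_of_invariant hν 1 (measurableSet_singleton y)
        rw [lintegral_add_left hT, lintegral_const_mul _ (κ.measurable_coe
          (measurableSet_singleton y)), ← this, pow_one]
    _ ≤ ∫⁻ z, (1 + ∫⁻ w, T w ∂κ z) ∂ν := lintegral_mono (truncatedReturnTime_add_mul_le y M)
    _ = ∫⁻ z, T z ∂ν + 1 := by
        rw [lintegral_add_left measurable_const, lintegral_of_invariant hν hT, add_comm]
        simp

lemma meanReturnTime_ne_top_of_invariant [IsMarkovKernel κ] [IsProbabilityMeasure ν]
    (hν : κ.Invariant ν) {y : X} (hy : 0 < ν {y}) : meanReturnTime κ y y ≠ ∞ := by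
  intro h
  simpa [h, ENNReal.top_mul hy.ne'] using meanReturnTime_mul_le_one hν y

lemma measure_singleton_pos_of_invariant [Countable X] [IsProbabilityMeasure ν]
    (hirr : IsIrreducibleChain κ) (hν : κ.Invariant ν) (x : X) : 0 < ν {x} := by
  obtain ⟨o, ho⟩ : ∃ o, ν {o} ≠ 0 := by
    by_contra! h
    exact NeZero.ne ν (Measure.ext_of_singleton fun z => by simp [h])
  obtain ⟨n, hn⟩ := hirr o x
  calc 0 < (κ ^ n) o {x} * ν {o} := ENNReal.mul_pos hn.ne' ho
    _ ≤ ∫⁻ z, (κ ^ n) z {x} ∂ν := lintegral_singleton_mul_le ν _ o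
    _ = ν {x} := lintegral_pow_apply_of_invariant hν n (measurableSet_singleton x)

/-- The occupation measure of an excursion from `y`, normalised to have mass one. -/
def stationaryLaw (κ : Kernel X X) (y : X) : Measure X :=
  (meanReturnTime κ y y)⁻¹ • greenKernel (taboo κ y) y

lemma isProbabilityMeasure_stationaryLaw {y : X} (h : meanReturnTime κ y y ≠ ∞) :
    IsProbabilityMeasure (stationaryLaw κ y) := by
  refine ⟨ENNReal.inv_mul_cancel ?_ h⟩
  rw [meanReturnTime_eq_one_add]
  simp

lemma lintegral_lintegral_greenKernel_taboo_add (κ : Kernel X X) (y : X) {f : X → ℝ≥0∞}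
    (hf : Measurable f) :
    ∫⁻ z, ∫⁻ w, f w ∂κ z ∂greenKernel (taboo κ y) y + f y =
      ∫⁻ z, f z ∂greenKernel (taboo κ y) y +
        f y * ∫⁻ z, κ z {y} ∂greenKernel (taboo κ y) y := by
  have hy := κ.measurable_coe (measurableSet_singleton y)
  simp_rw [← lintegral_taboo_add_mul κ y _ f]
  rw [lintegral_add_right _ (hy.const_mul _), lintegral_const_mul _ hy,
    ← add_lintegral_lintegral_greenKernel _ hf]
  ring

theorem stationaryLaw_invariant [IsMarkovKernel κ] {y : X} (h : meanReturnTime κ y y ≠ ∞) :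
    κ.Invariant (stationaryLaw κ y) := by
  have return_mass : ∫⁻ z, κ z {y} ∂greenKernel (taboo κ y) y = 1 := by
    have := lintegral_lintegral_greenKernel_taboo_add κ y measurable_one
    simp only [Pi.one_apply, lintegral_one, measure_univ, one_mul] at this
    exact ((ENNReal.add_right_inj h).1 this).symm
  have invariant : κ ∘ₘ greenKernel (taboo κ y) y = greenKernel (taboo κ y) y := by
    refine Measure.ext fun s hs => ?_
    have := lintegral_lintegral_greenKernel_taboo_add κ y (measurable_one.indicator hs)
    simp only [return_mass, lintegral_indicator_one hs, mul_one] at this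
    rw [Measure.bind_apply hs κ.aemeasurable]
    refine (ENNReal.add_left_inj ?_).1 this
    exact ((Set.indicator_le_self' (by simp) y).trans_lt ENNReal.one_lt_top).ne
  rw [Kernel.Invariant, stationaryLaw, Measure.comp_smul, invariant]

variable [Countable X] [IsMarkovKernel κ]

lemma meanReturnTime_ne_top_of_irreducible (hirr : IsIrreducibleChain κ) {o : X}
    (ho : meanReturnTime κ o o ≠ ∞) (x : X) : meanReturnTime κ x x ≠ ∞ :=
  have := isProbabilityMeasure_stationaryLaw ho
  have hinv := stationaryLaw_invariant ho
  meanReturnTime_ne_top_of_invariant hinv (measure_singleton_pos_of_invariant hirr hinv x)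

lemma escapeProb_eq_zero_of_irreducible (hirr : IsIrreducibleChain κ) {o : X}
    (ho : meanReturnTime κ o o ≠ ∞) (x z : X) : escapeProb κ x z = 0 :=
  escapeProb_eq_zero_of_reachable (escapeProb_eq_zero_of_meanReturnTime_ne_top
    (meanReturnTime_ne_top_of_irreducible hirr ho x)) (hirr x z)

theorem isPositiveRecurrent (hirr : IsIrreducibleChain κ) {o : X}
    (ho : meanReturnTime κ o o ≠ ∞) : IsPositiveRecurrent κ :=
  ⟨hirr, fun x => by
    rw [lintegral_returnTime]; exact (meanReturnTime_ne_top_of_irreducible hirr ho x).lt_top⟩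

theorem isNullRecurrent (hirr : IsIrreducibleChain κ) {o : X} (ho : escapeProb κ o o = 0)
    (hmean : meanReturnTime κ o o = ∞) : IsNullRecurrent κ := by
  refine ⟨hirr, fun x => ⟨ae_returnTime_lt_top (escapeProb_eq_zero_of_recurrent
    (fun z => escapeProb_eq_zero_of_reachable ho (hirr o z)) (hirr o x)) x, ?_⟩⟩
  rw [lintegral_returnTime]
  by_contra h
  exact meanReturnTime_ne_top_of_irreducible hirr h o hmean

end Invariant

section TotalVariation

variable {X : Type*} [MeasurableSpace X]

lemma tvDist_nonneg (μ ν : Measure X) : 0 ≤ tvDist μ ν :=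
  Real.iSup_nonneg fun _ => abs_nonneg _

lemma tvDist_self (μ : Measure X) : tvDist μ μ = 0 := by simp [tvDist]

lemma tvDist_le_of_le_add {μ ν : Measure X} [IsProbabilityMeasure μ] [IsProbabilityMeasure ν]
    {c : ℝ≥0∞} (hc : c ≠ ∞) (h : ∀ s, MeasurableSet s → μ s ≤ ν s + c) :
    tvDist μ ν ≤ c.toReal := by
  have real_le {s : Set X} (hs : MeasurableSet s) : μ.real s ≤ ν.real s + c.toReal := by
    have := ENNReal.toReal_mono (by finiteness) (h s hs)
    rwa [ENNReal.toReal_add (by finiteness) hc] at this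
  have : Nonempty {A : Set X // MeasurableSet A} := ⟨⟨∅, .empty⟩⟩
  refine ciSup_le fun ⟨A, hA⟩ => abs_le.2 ⟨?_, by linarith [real_le hA]⟩
  have compl := real_le hA.compl
  rw [probReal_compl_eq_one_sub hA, probReal_compl_eq_one_sub hA] at compl
  linarith

end TotalVariation

section Coupling

variable {X : Type*} [MeasurableSpace X] {κ : Kernel X X} [IsMarkovKernel κ]

lemma parallelComp_pow (κ : Kernel X X) [IsMarkovKernel κ] (n : ℕ) :
    (κ ∥ₖ κ) ^ n = (κ ^ n) ∥ₖ (κ ^ n) := by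
  induction n with
  | zero => rw [pow_zero, pow_zero]; exact Kernel.id_parallelComp_id.symm
  | succ n ih =>
    rw [pow_succ, pow_succ, ih]
    exact Kernel.parallelComp_comp_parallelComp

lemma parallelComp_invariant {ν : Measure X} [SFinite ν] (hν : κ.Invariant ν) :
    (κ ∥ₖ κ).Invariant (ν.prod ν) := by
  rw [Kernel.Invariant, ← Kernel.id_parallelComp_comp_parallelComp_id, ← Measure.comp_assoc,
    ← Measure.prod_comp_left, hν.def, ← Measure.prod_comp_right, hν.def]

variable [MeasurableSingletonClass X]

lemma pow_apply_le_add_survival (κ : Kernel X X) [IsMarkovKernel κ] (o : X) {s : Set X}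
    (hs : MeasurableSet s) (n : ℕ) (x y : X) :
    (κ ^ n) x s ≤ (κ ^ n) y s + survival (κ ∥ₖ κ) (o, o) n (x, y) := by
  induction n generalizing x y with
  | zero =>
    rw [survival_zero]
    exact prob_le_one.trans le_add_self
  | succ n ih =>
    have hn : Measurable fun w => (κ ^ n) w s := (κ ^ n).measurable_coe hs
    have first_step (z : X) : (κ ^ (n + 1)) z s = ∫⁻ w, (κ ^ n) w s ∂κ z := by
      rw [add_comm, Kernel.pow_add_apply_eq_lintegral κ 1 n z hs, pow_one]
    have fst : ∫⁻ w, (κ ^ n) w s ∂κ x = ∫⁻ p, (κ ^ n) p.1 s ∂(κ ∥ₖ κ) (x, y) := by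
      rw [Kernel.parallelComp_apply, measurePreserving_fst.lintegral_comp hn]
    have snd : ∫⁻ w, (κ ^ n) w s ∂κ y = ∫⁻ p, (κ ^ n) p.2 s ∂(κ ∥ₖ κ) (x, y) := by
      rw [Kernel.parallelComp_apply, measurePreserving_snd.lintegral_comp hn]
    calc (κ ^ (n + 1)) x s
        = ∫⁻ p, (κ ^ n) p.1 s ∂taboo (κ ∥ₖ κ) (o, o) (x, y) +
            (κ ^ n) o s * (κ ∥ₖ κ) (x, y) {(o, o)} := by
          rw [first_step, fst, ← lintegral_taboo_add_mul _ (o, o)]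
      _ ≤ ∫⁻ p, ((κ ^ n) p.2 s + survival (κ ∥ₖ κ) (o, o) n p) ∂taboo (κ ∥ₖ κ) (o, o) (x, y) +
            (κ ^ n) o s * (κ ∥ₖ κ) (x, y) {(o, o)} := by
          gcongr with p
          exact ih p.1 p.2
      _ = (κ ^ (n + 1)) y s + survival (κ ∥ₖ κ) (o, o) (n + 1) (x, y) := by
          have hsnd : Measurable fun p : X × X => (κ ^ n) p.2 s := hn.comp measurable_snd
          rw [lintegral_add_left hsnd, add_right_comm, first_step, snd, survival_succ,
            ← lintegral_taboo_add_mul (κ ∥ₖ κ) (o, o) (x, y) fun p => (κ ^ n) p.2 s]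

lemma exists_forall_pow_pos {κ : Kernel X X} (hirr : IsIrreducibleChain κ) {o : X}
    (ho : 0 < κ o {o}) (z : X) : ∃ N, ∀ n ≥ N, 0 < (κ ^ n) o {z} := by
  obtain ⟨N, hN⟩ := hirr o z
  refine ⟨N, fun n hn => ?_⟩
  obtain ⟨m, rfl⟩ := Nat.exists_eq_add_of_le' hn
  exact pow_pos_trans (pow_self_pos ho m) hN

lemma exists_parallelComp_pow_pos (hirr : IsIrreducibleChain κ) {o : X} (ho : 0 < κ o {o})
    (p : X × X) : ∃ n, 0 < ((κ ∥ₖ κ) ^ n) (o, o) {p} := by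
  obtain ⟨N, hN⟩ := exists_forall_pow_pos hirr ho p.1
  obtain ⟨M, hM⟩ := exists_forall_pow_pos hirr ho p.2
  refine ⟨max N M, ?_⟩
  rw [parallelComp_pow, ← Prod.mk.eta (p := p), ← Set.singleton_prod_singleton,
    Kernel.parallelComp_apply_prod]
  exact ENNReal.mul_pos (hN _ (le_max_left ..)).ne' (hM _ (le_max_right ..)).ne'

variable [Countable X] {ν : Measure X} [IsProbabilityMeasure ν]

lemma escapeProb_parallelComp_eq_zero (hirr : IsIrreducibleChain κ) (hν : κ.Invariant ν) {o : X}
    (ho : 0 < κ o {o}) (p : X × X) : escapeProb (κ ∥ₖ κ) (o, o) p = 0 := by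
  have charged : 0 < (ν.prod ν) {(o, o)} := by
    have := measure_singleton_pos_of_invariant hirr hν o
    rw [← Set.singleton_prod_singleton, Measure.prod_prod]
    exact ENNReal.mul_pos this.ne' this.ne'
  exact escapeProb_eq_zero_of_reachable (escapeProb_eq_zero_of_meanReturnTime_ne_top
    (meanReturnTime_ne_top_of_invariant (parallelComp_invariant hν) charged))
    (exists_parallelComp_pow_pos hirr ho p)

theorem tendsto_tvDist_pow (hirr : IsIrreducibleChain κ) (hν : κ.Invariant ν) {o : X}
    (ho : 0 < κ o {o}) (x : X) : Tendsto (fun n => tvDist ((κ ^ n) x) ν) atTop (𝓝 0) := by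
  set c : ℕ → ℝ≥0∞ := fun n => ∫⁻ p, survival (κ ∥ₖ κ) (o, o) n p ∂ν.map (Prod.mk x)
  have : IsProbabilityMeasure (ν.map (Prod.mk x)) := Measure.isProbabilityMeasure_map (by fun_prop)
  have c_finite (n : ℕ) : c n ≠ ∞ := by
    refine ne_top_of_le_ne_top ENNReal.one_ne_top ?_
    simpa using lintegral_mono (μ := ν.map (Prod.mk x)) (survival_le_one (κ := κ ∥ₖ κ) (o, o) n)
  have c_tendsto : Tendsto c atTop (𝓝 0) := by
    simpa [escapeProb_parallelComp_eq_zero hirr hν ho] using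
      tendsto_lintegral_survival (κ := κ ∥ₖ κ) (o, o) (ν.map (Prod.mk x))
  refine squeeze_zero (fun n => tvDist_nonneg _ _)
    (fun n => tvDist_le_of_le_add (c_finite n) fun s hs => ?_)
    ((ENNReal.tendsto_toReal ENNReal.zero_ne_top).comp c_tendsto)
  calc (κ ^ n) x s = ∫⁻ _, (κ ^ n) x s ∂ν := by simp
    _ ≤ ∫⁻ y, ((κ ^ n) y s + survival (κ ∥ₖ κ) (o, o) n (x, y)) ∂ν :=
        lintegral_mono fun y => pow_apply_le_add_survival κ o hs n x y
    _ = ν s + c n := by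
        rw [lintegral_add_left ((κ ^ n).measurable_coe hs),
          lintegral_pow_apply_of_invariant hν n hs,
          ← lintegral_map (measurable_survival _ _ n) measurable_prodMk_left]

end Coupling

section Ergodicity

variable {X : Type*} [MeasurableSpace X] {κ : Kernel X X} [IsMarkovKernel κ]

lemma pow_apply_cyclic_eq_one {d : ℕ} {E : ZMod d → Set X} (hE : ∀ i, MeasurableSet (E i))
    (hstep : ∀ i, ∀ x ∈ E i, κ x (E (i + 1)) = 1) (n : ℕ) {i : ZMod d} {x : X} (hx : x ∈ E i) :
    (κ ^ n) x (E (i + n)) = 1 := by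
  induction n generalizing i x with
  | zero => simp [kernel_one_apply, Measure.dirac_apply' _ (hE i), hx]
  | succ n ih =>
    have next : ∀ᵐ w ∂κ x, w ∈ E (i + 1) := (mem_ae_iff_prob_eq_one (hE _)).2 (hstep i x hx)
    rw [add_comm n, Kernel.pow_add_apply_eq_lintegral κ 1 n x (hE _), pow_one,
      lintegral_congr_ae (next.mono fun w hw => by
        simpa [add_assoc, add_comm (1 : ZMod d)] using ih hw)]
    simp

variable [MeasurableSingletonClass X]

lemma not_periodic (hirr : IsIrreducibleChain κ) {o : X} (ho : 0 < κ o {o}) {d : ℕ} (hd : 2 ≤ d)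
    {E : ZMod d → Set X} (hE : ∀ i, MeasurableSet (E i))
    (hdisj : Pairwise fun i j => Disjoint (E i) (E j))
    (hstep : ∀ i, ∀ x ∈ E i, κ x (E (i + 1)) = 1) : E 0 = ∅ := by
  refine Set.eq_empty_of_forall_notMem fun x hx => ?_
  have mem_of_pos {n : ℕ} (hn : 0 < (κ ^ n) x {o}) : o ∈ E n := by
    by_contra hoE
    have := pow_apply_cyclic_eq_one hE hstep n hx
    rw [zero_add, ← prob_compl_eq_zero_iff (hE n)] at this
    exact hn.ne' (measure_mono_null (Set.singleton_subset_iff.2 hoE) this)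
  obtain ⟨n, hn⟩ := hirr x o
  have : Fact (1 < d) := ⟨hd⟩
  refine Set.disjoint_left.1 (hdisj (by simp : (n : ZMod d) ≠ n + 1)) (mem_of_pos hn) ?_
  exact_mod_cast mem_of_pos (pow_pos_trans hn (by simpa using ho))

theorem harrisErgodic_stationaryLaw [Countable X] (hirr : IsIrreducibleChain κ) {o : X}
    (ho : 0 < κ o {o}) (hmean : meanReturnTime κ o o ≠ ∞) :
    HarrisErgodic κ (stationaryLaw κ o) where
  prob := isProbabilityMeasure_stationaryLaw hmean
  invariant := stationaryLaw_invariant hmean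
  irreducible := ⟨fun A _ hA x => by
    obtain ⟨y, hy⟩ := nonempty_of_measure_ne_zero hA.ne'
    obtain ⟨n, hn⟩ := hirr x y
    exact ⟨n, hn.trans_le (measure_mono (Set.singleton_subset_iff.2 hy))⟩⟩
  harris A _ hA x := by
    obtain ⟨y, hy⟩ := nonempty_of_measure_ne_zero hA.ne'
    exact (ae_frequently_visit (escapeProb_eq_zero_of_irreducible hirr hmean y) x).mono
      fun ω hω => hω.mono fun n hn => hn ▸ hy
  aperiodic := by
    rintro d hd ⟨E, hE, hdisj, hstep, hpos⟩
    simp [not_periodic hirr ho hd hE hdisj hstep] at hpos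
  tendsto :=
    have := isProbabilityMeasure_stationaryLaw hmean
    tendsto_tvDist_pow hirr (stationaryLaw_invariant hmean) ho

end Ergodicity

/-! ### Null recurrence and adversarial chains -/

section Escape

variable {X : Type*} [MeasurableSpace X] [MeasurableSingletonClass X] {κ : Kernel X X}

lemma lintegral_pow_apply_singleton (κ : Kernel X X) (n : ℕ) (x y : X) :
    ∫⁻ z, κ z {y} ∂(κ ^ n) x = (κ ^ (n + 1)) x {y} := by
  rw [Kernel.pow_add_apply_eq_lintegral κ n 1 x (measurableSet_singleton y), pow_one]

lemma sum_pow_apply_le {o : X} {s : Set X} (hs : MeasurableSet s) {V : X → ℝ≥0∞}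
    (hV : Measurable V) (h : ∀ z, z ≠ o → s.indicator 1 z + ∫⁻ w, V w ∂κ z ≤ V z) (N : ℕ) :
    ∑ n ∈ Finset.range N, (κ ^ n) o s ≤ (s.indicator 1 o + ∫⁻ w, V w ∂κ o) *
      (1 + ∑ n ∈ Finset.range N, (κ ^ (n + 1)) o {o}) := by
  set U : X → ℝ≥0∞ := fun z => s.indicator 1 z + ∫⁻ w, V w ∂κ z
  have measurable_U : Measurable U := (measurable_one.indicator hs).add hV.lintegral_kernel
  have drift (z : X) : s.indicator 1 z + ∫⁻ w, U w ∂κ z ≤ U z + U o * κ z {o} := by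
    rw [← lintegral_taboo_add_mul κ o z, ← add_assoc]
    exact add_le_add_left (add_lintegral_taboo_le h z) _
  have := le_self_add.trans
    (sum_lintegral_pow_add_le (measurable_one.indicator hs) measurable_U drift N o)
  simpa [lintegral_indicator_one hs, lintegral_const_mul _
    (κ.measurable_coe (measurableSet_singleton o)), lintegral_pow_apply_singleton, mul_add,
    Finset.mul_sum, -mul_eq_mul_left_iff] using this

lemma truncatedReturnTime_mul_le [IsMarkovKernel κ] (o : X) (N : ℕ) :
    truncatedReturnTime κ o N o * (1 + ∑ n ∈ Finset.range N, (κ ^ (n + 1)) o {o}) ≤ 2 * N := by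
  have drift := add_sum_lintegral_pow_le measurable_one (measurable_truncatedReturnTime κ o N)
    (truncatedReturnTime_add_mul_le o N) N o
  calc truncatedReturnTime κ o N o * (1 + ∑ n ∈ Finset.range N, (κ ^ (n + 1)) o {o})
      ≤ N + ∫⁻ w, truncatedReturnTime κ o N w ∂(κ ^ N) o := by
        simpa [lintegral_const_mul _ (κ.measurable_coe (measurableSet_singleton o)),
          lintegral_pow_apply_singleton, mul_add, Finset.mul_sum] using drift
    _ ≤ N + N := by
        gcongr
        simpa using lintegral_mono (μ := (κ ^ N) o) (truncatedReturnTime_le (κ := κ) o N)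
    _ = 2 * N := (two_mul _).symm

/-- Up to constants, the number of visits to `o` before time `N` is `N` divided by the mean of the
return time truncated at `N`, hence `o(N)`; the mean time spent in `s` between two visits to `o`
is bounded by means of the potential `V`. -/
theorem exists_pow_apply_lt [IsMarkovKernel κ] {o : X} (hmean : meanReturnTime κ o o = ∞)
    {s : Set X} (hs : MeasurableSet s) {V : X → ℝ≥0∞} (hV : Measurable V) (hVo : ∫⁻ w, V w ∂κ o ≠ ∞)
    (h : ∀ z, z ≠ o → s.indicator 1 z + ∫⁻ w, V w ∂κ z ≤ V z) {c : ℝ≥0∞} (hc : c ≠ 0) :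
    ∃ n, (κ ^ n) o s < c := by
  by_contra! hcon
  have c_finite : c ≠ ∞ := ne_top_of_le_ne_top ENNReal.one_ne_top ((hcon 0).trans prob_le_one)
  set C := s.indicator 1 o + ∫⁻ w, V w ∂κ o
  have C_finite : C ≠ ∞ := ENNReal.add_ne_top.2
    ⟨ne_top_of_le_ne_top ENNReal.one_ne_top (Set.indicator_le_self s 1 o), hVo⟩
  have truncated_le (N : ℕ) : truncatedReturnTime κ o N o ≤ C * 2 / c := by
    rcases N.eq_zero_or_pos with rfl | hN
    · simp [truncatedReturnTime]
    rw [ENNReal.le_div_iff_mul_le (.inl hc) (.inl c_finite)]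
    set T := truncatedReturnTime κ o N o
    set u := 1 + ∑ n ∈ Finset.range N, (κ ^ (n + 1)) o {o}
    refine (ENNReal.mul_le_mul_iff_right (a := (N : ℝ≥0∞)) (by positivity) (by simp)).1 ?_
    calc N * (T * c) = (∑ _ ∈ Finset.range N, c) * T := by simp; ring
      _ ≤ (∑ n ∈ Finset.range N, (κ ^ n) o s) * T := by gcongr with n; exact hcon n
      _ ≤ C * u * T := by gcongr; exact sum_pow_apply_le hs hV h N
      _ = C * (T * u) := by ring
      _ ≤ C * (2 * N) := mul_le_mul_right (truncatedReturnTime_mul_le o N) _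
      _ = N * (C * 2) := by ring
  have mean_le := ENNReal.tsum_le_of_sum_range_le truncated_le
  rw [← meanReturnTime_eq_tsum, hmean, top_le_iff] at mean_le
  exact ENNReal.div_ne_top (ENNReal.mul_ne_top C_finite (by simp)) hc mean_le

end Escape

section Adversary

variable {X : Type*} [MetricSpace X] [MeasurableSpace X] [BorelSpace X] {S : AdversarialSetup X}
  {κ : Kernel X X} [IsMarkovKernel κ]

theorem not_boundedInProbability_chainLaw {x : X}
    (h : ∀ L : ℝ, ∃ n, (κ ^ n) x {y | dist y S.origin ≤ L} < 2⁻¹) :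
    ¬ S.BoundedInProbability (chainLaw κ x) (fun n ω => ω n) := by
  intro bounded
  obtain ⟨L, hL⟩ := (bounded.eventually_lt_const (u := 2⁻¹) (by simp)).exists
  obtain ⟨n, hn⟩ := h L
  have near : MeasurableSet {y | dist y S.origin ≤ L} := measurableSet_closedBall
  have far : (κ ^ n) x {y | dist y S.origin ≤ L}ᶜ < 2⁻¹ := by
    rw [← chainLaw_map_eval, Measure.map_apply (measurable_pi_apply n) near.compl]
    refine lt_of_le_of_lt (measure_mono fun ω hω => ?_)
      ((le_iSup (fun n => chainLaw κ x {ω | L < dist (ω n) S.origin}) n).trans_lt hL)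
    simpa using hω
  have := ENNReal.add_lt_add hn far
  rw [prob_add_prob_compl near, ENNReal.inv_two_add_inv_two] at this
  exact lt_irrefl _ this

theorem isAdversarialChain_chainLaw [SecondCountableTopology X] (hκ : ∀ x ∉ S.K, κ x = S.P x)
    (hjump : ∀ x, κ x {y | dist x y ≤ S.D} = 1) :
    S.IsAdversarialChain (chainLaw κ S.x₀) (fun n ω => ω n) where
  prob := inferInstance
  measurable := measurable_pi_apply
  initial := by
    refine ae_of_ae_map (f := fun ω : ℕ → X => ω 0) (p := (· = S.x₀))
      (measurable_pi_apply 0).aemeasurable ?_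
    rw [chainLaw_map_zero]
    exact (ae_dirac_iff (measurableSet_singleton _)).2 rfl
  follows n A hA := by
    filter_upwards [isMarkovChain_chainLaw κ S.x₀ n A hA] with ω markov outside
    rw [markov, hκ _ outside]
  adversary n := by
    have near : MeasurableSet {p : X × X | dist p.1 p.2 ≤ S.D} :=
      measurableSet_le (by fun_prop) measurable_const
    filter_upwards [ae_chainLaw_succ (κ := κ) S.x₀ n (R := fun x y => dist x y ≤ S.D) near
      fun z => (mem_ae_iff_prob_eq_one (near.preimage measurable_prodMk_left)).2 (hjump z)]
      with ω step inside
    exact ⟨ω n, inside, step⟩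

end Adversary

/-! ### The tower walks -/

/-- The states of the tower walks: a base and, for each `a`, a tower of cells indexed by height. -/
inductive Site
  | base : Site
  | cell (a n : ℕ) : Site

namespace Site

/-- The horizontal coordinate of a site. By `1 / 0 = 0` the towers accumulate at the tower `0`. -/
def abscissa : Site → ℝ
  | base => 0
  | cell a _ => 1 / a

/-- The vertical coordinate of a site: the base lies just below the lowest cells. -/
def height : Site → ℕ
  | base => 0
  | cell _ n => n + 1

/-- The position of a site in the plane. -/
def position (s : Site) : EuclideanSpace ℝ (Fin 2) := !₂[s.abscissa, s.height]

lemma eq_base_of_height_eq_zero {s : Site} (h : s.height = 0) : s = base := by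
  cases s <;> simp_all [height]

lemma eq_cell_of_height_eq_succ {s : Site} {n : ℕ} (h : s.height = n + 1) : ∃ a, s = cell a n := by
  cases s <;> simp_all [height]

lemma position_injective : Function.Injective position := by
  intro s t h
  have same_abscissa : s.abscissa = t.abscissa := by
    simpa [position] using congrArg (fun v => v 0) h
  have same_height : s.height = t.height := by simpa [position] using congrArg (fun v => v 1) h
  rcases s with _ | ⟨a, n⟩
  · exact (eq_base_of_height_eq_zero same_height.symm).symm
  · obtain ⟨b, rfl⟩ := eq_cell_of_height_eq_succ same_height.symm
    simpa [abscissa] using same_abscissa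

instance : Countable Site :=
  Function.Surjective.countable (f := fun p : Option (ℕ × ℕ) => p.elim base fun q => cell q.1 q.2)
    fun
      | base => ⟨none, rfl⟩
      | cell a n => ⟨some (a, n), rfl⟩

lemma abscissa_mem_Icc (s : Site) : s.abscissa ∈ Set.Icc (0 : ℝ) 1 := by
  rcases s with _ | ⟨_ | a, n⟩
  · simp [abscissa]
  · simp [abscissa]
  · exact ⟨by simp only [abscissa]; positivity,
      (div_le_one (by positivity)).2 (by simp)⟩

end Site

open Site

/-- The state space: the positions of all sites in the plane. -/
def towers : Set (EuclideanSpace ℝ (Fin 2)) := Set.range position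

/-- The point of the state space that represents a site. -/
def site : Site ≃ towers := Equiv.ofInjective position position_injective

lemma countable_towers : towers.Countable := Set.countable_range _

instance : Countable towers := countable_towers

lemma towers_eq : towers = {position base} ∪
    ((fun v => v 0) ⁻¹' Set.range (fun a : ℕ => (1 : ℝ) / a) ∩
      (fun v => v 1) ⁻¹' Set.range (fun n : ℕ => ((n + 1 : ℕ) : ℝ))) := by
  ext v
  constructor
  · rintro ⟨_ | ⟨a, n⟩, rfl⟩
    · exact .inl rfl
    · exact .inr ⟨⟨a, rfl⟩, ⟨n, rfl⟩⟩
  · rintro (hv | ⟨⟨a, ha⟩, ⟨n, hn⟩⟩)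
    · exact ⟨base, hv.symm⟩
    · refine ⟨cell a n, ?_⟩
      ext i
      fin_cases i
      exacts [ha, hn]

lemma isClosed_range_one_div : IsClosed (Set.range fun a : ℕ => (1 : ℝ) / a) := by
  have := (tendsto_one_div_atTop_nhds_zero_nat (𝕜 := ℝ)).isCompact_insert_range.isClosed
  rwa [Set.insert_eq_of_mem (Set.mem_range.2 ⟨0, by simp⟩)] at this

lemma isClosed_range_natCast_succ : IsClosed (Set.range fun n : ℕ => ((n + 1 : ℕ) : ℝ)) := by
  rw [show (fun n : ℕ => ((n + 1 : ℕ) : ℝ)) = Nat.cast ∘ Nat.succ from rfl, Set.range_comp]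
  exact Nat.isClosedEmbedding_coe_real.isClosedMap _ (isClosed_discrete _)

lemma isClosed_towers : IsClosed towers := by
  rw [towers_eq]
  exact isClosed_singleton.union ((isClosed_range_one_div.preimage (by fun_prop)).inter
    (isClosed_range_natCast_succ.preimage (by fun_prop)))

lemma dist_site_sq (s t : Site) : dist (site s) (site t) ^ 2 =
    (s.abscissa - t.abscissa) ^ 2 + ((s.height : ℝ) - t.height) ^ 2 := by
  change dist (position s) (position t) ^ 2 = _
  rw [EuclideanSpace.dist_eq, Real.sq_sqrt (by positivity)]
  simp [Fin.sum_univ_two, position, Real.dist_eq, sq_abs]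

lemma abs_abscissa_sub_le (s t : Site) :
    |s.abscissa - t.abscissa| ≤ dist (site s) (site t) := by
  refine abs_le_of_sq_le_sq ?_ dist_nonneg
  rw [dist_site_sq]
  exact le_add_of_nonneg_right (sq_nonneg _)

lemma abs_height_sub_le (s t : Site) : |(s.height : ℝ) - t.height| ≤ dist (site s) (site t) := by
  refine abs_le_of_sq_le_sq ?_ dist_nonneg
  rw [dist_site_sq]
  exact le_add_of_nonneg_left (sq_nonneg _)

lemma dist_site_le_two {s t : Site} (h : |(s.height : ℝ) - t.height| ≤ 1) :
    dist (site s) (site t) ≤ 2 := by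
  have habs : |s.abscissa - t.abscissa| ≤ 1 :=
    (abs_sub_le_of_le_of_le s.abscissa_mem_Icc.1 s.abscissa_mem_Icc.2 t.abscissa_mem_Icc.1
      t.abscissa_mem_Icc.2).trans_eq (sub_zero 1)
  refine (sq_le_sq₀ dist_nonneg two_pos.le).1 ?_
  rw [dist_site_sq]
  linarith [(sq_le_one_iff_abs_le_one _).2 h, (sq_le_one_iff_abs_le_one _).2 habs]

lemma height_eq_of_dist_lt_one {s t : Site} (h : dist (site s) (site t) < 1) :
    s.height = t.height := by
  have hlt : |(s.height - t.height : ℤ)| < 1 := by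
    exact_mod_cast (abs_height_sub_le s t).trans_lt h
  exact_mod_cast sub_eq_zero.1 (Int.abs_lt_one_iff.1 hlt)

lemma eq_of_abs_one_div_sub_lt {a b : ℕ} (ha : a ≠ 0)
    (h : |(1 : ℝ) / a - 1 / b| < 1 / a - 1 / (a + 1)) : b = a := by
  obtain ⟨lower, upper⟩ := abs_lt.1 h
  rcases b.eq_zero_or_pos with rfl | hb
  · have : (0 : ℝ) < 1 / (a + 1) := by positivity
    rw [Nat.cast_zero, div_zero] at upper
    linarith
  have b_pos : (0 : ℝ) < b := by positivity
  refine le_antisymm ?_ (not_lt.1 fun hlt => ?_)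
  · have := (one_div_lt_one_div (by positivity) b_pos).1
      (show (1 : ℝ) / (a + 1) < 1 / b by linarith)
    exact Nat.lt_succ_iff.1 (by exact_mod_cast this)
  · have hle : (b : ℝ) + 1 ≤ a := by exact_mod_cast hlt
    have two_sub : (2 : ℝ) / a - 1 / (a + 1) = (a + 2) / (a * (a + 1)) := by field_simp; ring
    have : (1 : ℝ) / b < (a + 2) / (a * (a + 1)) := by rw [← two_sub]; linear_combination lower
    rw [div_lt_div_iff₀ b_pos (by positivity)] at this
    nlinarith

lemma eq_cell_of_dist_lt_one {a n : ℕ} {t : Site} (h : dist (site (cell a n)) (site t) < 1) :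
    ∃ b, t = cell b n :=
  eq_cell_of_height_eq_succ (height_eq_of_dist_lt_one h).symm

lemma exists_dist_lt_imp_eq {s : Site} (hs : ∀ n, s ≠ cell 0 n) :
    ∃ δ > 0, ∀ t, dist (site s) (site t) < δ → t = s := by
  rcases s with _ | ⟨a, n⟩
  · exact ⟨1, one_pos, fun t ht => eq_base_of_height_eq_zero (height_eq_of_dist_lt_one ht).symm⟩
  have a_ne_zero : a ≠ 0 := by rintro rfl; exact hs n rfl
  have a_pos : (0 : ℝ) < a := by positivity
  refine ⟨min 1 (1 / a - 1 / (a + 1)), lt_min one_pos (sub_pos.2 ?_), fun t ht => ?_⟩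
  · exact one_div_lt_one_div_of_lt a_pos (lt_add_one _)
  obtain ⟨b, rfl⟩ := eq_cell_of_dist_lt_one (ht.trans_le (min_le_left _ _))
  rw [eq_of_abs_one_div_sub_lt a_ne_zero
    ((abs_abscissa_sub_le _ _).trans_lt (ht.trans_le (min_le_right _ _)))]

lemma exists_dist_cell_zero_lt_imp (n N : ℕ) : ∃ δ > 0, ∀ t,
    dist (site (cell 0 n)) (site t) < δ → ∃ b, t = cell b n ∧ (b = 0 ∨ N ≤ b) := by
  refine ⟨1 / (N + 1), by positivity, fun t ht => ?_⟩
  obtain ⟨b, rfl⟩ := eq_cell_of_dist_lt_one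
    (ht.trans_le ((div_le_one (by positivity)).2 (by simp)))
  refine ⟨b, rfl, b.eq_zero_or_pos.imp_right fun hb => ?_⟩
  have close := (abs_abscissa_sub_le _ _).trans_lt ht
  simp only [abscissa, Nat.cast_zero, div_zero, zero_sub, abs_neg] at close
  rw [abs_of_pos (by positivity), one_div_lt_one_div (by positivity) (by positivity)] at close
  exact (Nat.lt_of_succ_lt (by exact_mod_cast close)).le

/-- The probability of leaving the tower `a` in one step from a height of at least `a`. -/
def decay (a : ℕ) : ℝ≥0∞ := (4 * (a + 1) : ℝ≥0∞)⁻¹ ^ a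

/-- The probability of climbing from the height `n` in the tower `a`. For fixed `n` it tends to `0`
as `a` grows, which makes the walk continuous at the tower `0`, where it only descends. -/
def climb (a n : ℕ) : ℝ≥0∞ := if n < a then (a + 1)⁻¹ else 1 - decay a

lemma decay_zero : decay 0 = 1 := pow_zero _

lemma decay_pos (a : ℕ) : 0 < decay a :=
  ENNReal.pow_pos (ENNReal.inv_pos.2 (by finiteness)) a

lemma decay_le_quarter {a : ℕ} (ha : a ≠ 0) : decay a ≤ 4⁻¹ := by
  have base_le : (4 * (a + 1) : ℝ≥0∞)⁻¹ ≤ 4⁻¹ :=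
    ENNReal.inv_le_inv.2 (le_mul_of_one_le_right zero_le le_add_self)
  exact (pow_le_of_le_one zero_le (base_le.trans (by norm_num)) ha).trans base_le

lemma decay_le_one (a : ℕ) : decay a ≤ 1 := by
  rcases eq_or_ne a 0 with rfl | ha
  · exact decay_zero.le
  · exact (decay_le_quarter ha).trans (by norm_num)

lemma decay_ne_top (a : ℕ) : decay a ≠ ∞ := ne_top_of_le_ne_top ENNReal.one_ne_top (decay_le_one a)

lemma climb_add_decay_le_one (a n : ℕ) : climb a n + decay a ≤ 1 := by
  unfold climb
  split_ifs with h
  · have two_le : (2 : ℝ≥0∞) ≤ a + 1 := by exact_mod_cast Nat.succ_le_succ (Nat.one_le_of_lt h)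
    calc ((a : ℝ≥0∞) + 1)⁻¹ + decay a ≤ 2⁻¹ + 2⁻¹ :=
          add_le_add (ENNReal.inv_le_inv.2 two_le) ((decay_le_quarter (Nat.ne_zero_of_lt h)).trans
            (ENNReal.inv_le_inv.2 (by norm_num)))
      _ = 1 := ENNReal.inv_two_add_inv_two
  · exact (tsub_add_cancel_of_le (decay_le_one a)).le

lemma climb_le_one (a n : ℕ) : climb a n ≤ 1 := le_self_add.trans (climb_add_decay_le_one a n)

lemma climb_zero (n : ℕ) : climb 0 n = 0 := by simp [climb, decay_zero]

lemma climb_lt_one (a n : ℕ) : climb a n < 1 :=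
  (ENNReal.lt_add_right (ne_top_of_le_ne_top ENNReal.one_ne_top (climb_le_one a n))
    (decay_pos a).ne').trans_le (climb_add_decay_le_one a n)

lemma climb_pos {a : ℕ} (ha : a ≠ 0) (n : ℕ) : 0 < climb a n := by
  unfold climb
  split_ifs
  · exact ENNReal.inv_pos.2 (by finiteness)
  · exact tsub_pos_of_lt ((decay_le_quarter ha).trans_lt (ENNReal.inv_lt_one.2 (by norm_num)))

lemma tendsto_climb (n : ℕ) : Tendsto (fun a => climb a n) atTop (𝓝 0) := by
  refine ((ENNReal.tendsto_inv_nat_nhds_zero).comp (tendsto_add_atTop_nat 1)).congr' ?_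
  filter_upwards [eventually_gt_atTop n] with a ha
  simp [climb, ha]

/-- The site below a cell at the height `n`, always in the tower `0`. -/
def below : ℕ → Site
  | 0 => base
  | n + 1 => cell 0 n

/-- The law of one step of the tower walk with launch weights `w`: from the base, the walk jumps to
the bottom of the tower `a` with probability `w a` and otherwise stays; from a cell, it climbs in
the same tower or descends into the tower `0`. -/
def step (w : ℕ → ℝ≥0∞) : Site → Measure towers
  | base => Measure.sum (fun a => w a • Measure.dirac (site (cell a 0))) +
      (1 - ∑' a, w a) • Measure.dirac (site base)
  | cell a n => climb a n • Measure.dirac (site (cell a (n + 1))) +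
      (1 - climb a n) • Measure.dirac (site (below n))

/-- The tower walk with launch weights `w`. -/
def walk (w : ℕ → ℝ≥0∞) : Kernel towers towers where
  toFun x := step w (site.symm x)
  measurable' := .of_discrete

section Walk

variable (w : ℕ → ℝ≥0∞)

lemma walk_base : walk w (site base) =
    Measure.sum (fun a => w a • Measure.dirac (site (cell a 0))) +
      (1 - ∑' a, w a) • Measure.dirac (site base) :=
  congrArg (step w) (site.symm_apply_apply base)

lemma walk_cell (a n : ℕ) : walk w (site (cell a n)) =
    climb a n • Measure.dirac (site (cell a (n + 1))) +
      (1 - climb a n) • Measure.dirac (site (below n)) :=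
  congrArg (step w) (site.symm_apply_apply (cell a n))

lemma lintegral_walk_base (f : towers → ℝ≥0∞) : ∫⁻ y, f y ∂walk w (site base) =
    ∑' a, w a * f (site (cell a 0)) + (1 - ∑' a, w a) * f (site base) := by
  simp [walk_base, lintegral_add_measure, lintegral_sum_measure]

lemma lintegral_walk_cell (a n : ℕ) (f : towers → ℝ≥0∞) : ∫⁻ y, f y ∂walk w (site (cell a n)) =
    climb a n * f (site (cell a (n + 1))) + (1 - climb a n) * f (site (below n)) := by
  simp [walk_cell, lintegral_add_measure]

lemma lintegral_walk_cell_le {a n : ℕ} {f : towers → ℝ≥0∞} {c : ℝ≥0∞}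
    (climbing : f (site (cell a (n + 1))) ≤ c) (descending : f (site (below n)) ≤ c) :
    ∫⁻ y, f y ∂walk w (site (cell a n)) ≤ c := by
  calc ∫⁻ y, f y ∂walk w (site (cell a n)) ≤ climb a n * c + (1 - climb a n) * c := by
        rw [lintegral_walk_cell]; gcongr
    _ = c := by rw [← add_mul, add_tsub_cancel_of_le (climb_le_one a n), one_mul]

lemma height_below (n : ℕ) : (below n).height = n := by
  cases n <;> rfl

lemma walk_apply_eq_one (hw : ∑' a, w a ≤ 1) {s : Site} {A : Set towers}
    (h : ∀ t : Site, |(s.height : ℝ) - t.height| ≤ 1 → site t ∈ A) : walk w (site s) A = 1 := by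
  rw [← lintegral_indicator_one .of_discrete]
  rcases s with _ | ⟨a, n⟩
  · have staying : site base ∈ A := h _ (by simp)
    have launching (a : ℕ) : site (cell a 0) ∈ A := h _ (by simp [height])
    simp [lintegral_walk_base, staying, launching, add_tsub_cancel_of_le hw]
  · have climbing : site (cell a (n + 1)) ∈ A := h _ (by simp [height])
    have descending : site (below n) ∈ A := h _ (by rw [height_below]; simp [height])
    simp [lintegral_walk_cell, climbing, descending, add_tsub_cancel_of_le (climb_le_one a n)]

lemma isMarkovKernel_walk (hw : ∑' a, w a ≤ 1) : IsMarkovKernel (walk w) :=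
  ⟨site.surjective.forall.2 fun _ => ⟨walk_apply_eq_one w hw fun _ _ => trivial⟩⟩

lemma walk_dist_le (hw : ∑' a, w a ≤ 1) : ∀ x, walk w x {y | dist x y ≤ 2} = 1 :=
  site.surjective.forall.2 fun _ => walk_apply_eq_one w hw fun _ ht => dist_site_le_two ht

lemma walk_eq_of_ne_base (w' : ℕ → ℝ≥0∞) {x : towers} (hx : x ≠ site base) :
    walk w x = walk w' x := by
  obtain ⟨_ | ⟨a, n⟩, rfl⟩ := site.surjective x
  · exact absurd rfl hx
  · rw [walk_cell, walk_cell]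

lemma tvDist_walk_cell_le [IsMarkovKernel (walk w)] (b n : ℕ) :
    tvDist (walk w (site (cell b n))) (walk w (site (cell 0 n))) ≤ (climb b n).toReal := by
  have descending : walk w (site (cell 0 n)) = Measure.dirac (site (below n)) := by
    simp [walk_cell, climb_zero]
  rw [descending]
  refine tvDist_le_of_le_add (ne_top_of_le_ne_top ENNReal.one_ne_top (climb_le_one b n))
    fun A _ => ?_
  rw [walk_cell, add_comm]
  exact add_le_add (mul_le_of_le_one_left zero_le tsub_le_self)
    (mul_le_of_le_one_right zero_le prob_le_one)

theorem tvContinuous_walk [IsMarkovKernel (walk w)] : TVContinuous (walk w) := by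
  refine site.surjective.forall.2 fun s ε hε => ?_
  by_cases hs : ∀ n, s ≠ cell 0 n
  · obtain ⟨δ, δ_pos, isolated⟩ := exists_dist_lt_imp_eq hs
    refine ⟨δ, δ_pos, site.surjective.forall.2 fun t ht => ?_⟩
    rwa [isolated t ht, tvDist_self]
  push Not at hs
  obtain ⟨n, rfl⟩ := hs
  obtain ⟨N, hN⟩ := eventually_atTop.1 (((ENNReal.tendsto_toReal ENNReal.zero_ne_top).comp
    (tendsto_climb n)).eventually_lt_const hε)
  obtain ⟨δ, δ_pos, close⟩ := exists_dist_cell_zero_lt_imp n N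
  refine ⟨δ, δ_pos, site.surjective.forall.2 fun t ht => ?_⟩
  obtain ⟨b, rfl, rfl | hb⟩ := close t ht
  · rwa [tvDist_self]
  · exact (tvDist_walk_cell_le w b n).trans_lt (hN b hb)

lemma le_walk_base_apply (a : ℕ) : w a ≤ walk w (site base) {site (cell a 0)} := by
  rw [← lintegral_indicator_one .of_discrete, lintegral_walk_base]
  exact le_add_right (le_trans (by simp) (ENNReal.le_tsum a))

lemma climb_le_walk_cell_apply (a n : ℕ) :
    climb a n ≤ walk w (site (cell a n)) {site (cell a (n + 1))} := by
  rw [← lintegral_indicator_one .of_discrete, lintegral_walk_cell]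
  exact le_add_right (by simp)

lemma one_sub_climb_le_walk_cell_apply (a n : ℕ) :
    1 - climb a n ≤ walk w (site (cell a n)) {site (below n)} := by
  rw [← lintegral_indicator_one .of_discrete, lintegral_walk_cell]
  exact le_add_left (by simp)

variable {w}

theorem isIrreducibleChain_walk (hw : ∀ a, 0 < w a) : IsIrreducibleChain (walk w) := by
  set R := Relation.ReflTransGen fun x y => 0 < walk w x {y}
  have descend (a n : ℕ) : 0 < walk w (site (cell a n)) {site (below n)} :=
    (tsub_pos_of_lt (climb_lt_one a n)).trans_le (one_sub_climb_le_walk_cell_apply w a n)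
  have below_base (n : ℕ) : R (site (below n)) (site base) := by
    induction n with
    | zero => exact .refl
    | succ n ih => exact .head (descend 0 n) ih
  have to_base (s : Site) : R (site s) (site base) := by
    rcases s with _ | ⟨a, n⟩
    · exact .refl
    · exact .head (descend a n) (below_base n)
  have base_cell {a : ℕ} (ha : a ≠ 0) (n : ℕ) : R (site base) (site (cell a n)) := by
    induction n with
    | zero => exact .single ((hw a).trans_le (le_walk_base_apply w a))
    | succ n ih => exact ih.tail ((climb_pos ha n).trans_le (climb_le_walk_cell_apply w a n))
  have from_base (s : Site) : R (site base) (site s) := by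
    rcases s with _ | ⟨_ | a, n⟩
    · exact .refl
    · exact (base_cell one_ne_zero (n + 1)).tail (descend 1 (n + 1))
    · exact base_cell a.succ_ne_zero n
  exact site.surjective.forall₂.2 fun s t =>
    exists_pow_pos_of_reflTransGen ((to_base s).trans (from_base t))

end Walk

/-- A potential that bounds the mean time until the walk, started at a site other than the base,
reaches the base: the mean time until the first descent from the tower `a`, and then the height
attained, since the tower `0` leads straight down. -/
def meanBound : Site → ℝ≥0∞
  | base => 0
  | cell a n => n + 2 * (decay a)⁻¹

lemma meanBound_below_le (n : ℕ) : meanBound (below n) ≤ n + 1 := by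
  cases n with
  | zero => exact zero_le
  | succ n => simp [below, meanBound, decay_zero, add_assoc, one_add_one_eq_two]

lemma meanBound_ne_top (s : Site) : meanBound s ≠ ∞ := by
  cases s with
  | base => exact ENNReal.zero_ne_top
  | cell a n => exact ENNReal.add_ne_top.2 ⟨by simp, ENNReal.mul_ne_top (by simp)
      (ENNReal.inv_ne_top.2 (decay_pos a).ne')⟩

lemma one_add_climb_mul_inv_decay_le (a n : ℕ) :
    1 + climb a n * (decay a)⁻¹ ≤ (decay a)⁻¹ := by
  calc 1 + climb a n * (decay a)⁻¹ = (climb a n + decay a) * (decay a)⁻¹ := by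
        rw [add_mul, ENNReal.mul_inv_cancel (decay_pos a).ne' (decay_ne_top a), add_comm]
    _ ≤ (decay a)⁻¹ := mul_le_of_le_one_left zero_le (climb_add_decay_le_one a n)

lemma one_add_lintegral_meanBound_le (w : ℕ → ℝ≥0∞) (a n : ℕ) :
    1 + ∫⁻ x, meanBound (site.symm x) ∂walk w (site (cell a n)) ≤ meanBound (cell a n) := by
  simp only [lintegral_walk_cell, Equiv.symm_apply_apply, meanBound]
  set c := climb a n
  calc 1 + (c * ((n + 1 : ℕ) + 2 * (decay a)⁻¹) + (1 - c) * meanBound (below n))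
      ≤ 1 + (c * ((n + 1 : ℕ) + 2 * (decay a)⁻¹) + (1 - c) * (n + 1)) := by
        gcongr
        exact meanBound_below_le n
    _ = 1 + ((c + (1 - c)) * (n + 1) + 2 * (c * (decay a)⁻¹)) := by push_cast; ring
    _ = n + 2 * (1 + c * (decay a)⁻¹) := by
        rw [add_tsub_cancel_of_le (climb_le_one a n)]; ring
    _ ≤ n + 2 * (decay a)⁻¹ := by
        gcongr
        exact one_add_climb_mul_inv_decay_le a n

theorem meanReturnTime_walk_le (w : ℕ → ℝ≥0∞) (x : towers) :
    meanReturnTime (walk w) (site base) x ≤ 1 + ∫⁻ y, meanBound (site.symm y) ∂walk w x := by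
  refine meanReturnTime_le .of_discrete (site.surjective.forall.2 ?_) x
  rintro (_ | ⟨a, n⟩) hs
  · exact absurd rfl hs
  · simpa only [Equiv.symm_apply_apply] using one_add_lintegral_meanBound_le w a n

theorem escapeProb_walk_base (w : ℕ → ℝ≥0∞) [IsMarkovKernel (walk w)] :
    escapeProb (walk w) (site base) (site base) = 0 := by
  refine escapeProb_self_eq_zero (site.surjective.forall.2 ?_)
  rintro (_ | ⟨a, n⟩) hs
  · exact absurd rfl hs
  · exact escapeProb_eq_zero_of_meanReturnTime_ne_top (ne_top_of_le_ne_top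
      (meanBound_ne_top (cell a n))
      ((meanReturnTime_walk_le w _).trans (one_add_lintegral_meanBound_le w a n)))

lemma one_add_climb_mul_meanReturnTime_le (w : ℕ → ℝ≥0∞) (a n : ℕ) :
    1 + climb a n * meanReturnTime (walk w) (site base) (site (cell a (n + 1))) ≤
      meanReturnTime (walk w) (site base) (site (cell a n)) := by
  refine le_trans ?_ (one_add_mul_meanReturnTime_le (walk w)
    (site.injective.ne (by simp : cell a (n + 1) ≠ base)) (site (cell a n)))
  gcongr
  exact climb_le_walk_cell_apply w a n

lemma inv_decay_le_meanReturnTime (w : ℕ → ℝ≥0∞) (a : ℕ) :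
    (decay a)⁻¹ ≤ meanReturnTime (walk w) (site base) (site (cell a a)) := by
  have geometric (m n : ℕ) (hn : a ≤ n) : ∑ i ∈ Finset.range m, (1 - decay a) ^ i ≤
      meanReturnTime (walk w) (site base) (site (cell a n)) := by
    induction m generalizing n with
    | zero => simp
    | succ m ih =>
      refine le_trans ?_ (one_add_climb_mul_meanReturnTime_le w a n)
      rw [climb, if_neg (Nat.not_lt.2 hn), Finset.sum_range_succ', pow_zero, add_comm]
      simp only [pow_succ', ← Finset.mul_sum]
      gcongr
      exact ih (n + 1) (Nat.le_succ_of_le hn)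
  have := ENNReal.tsum_le_of_sum_range_le fun m => geometric m a le_rfl
  rwa [ENNReal.tsum_geometric, ENNReal.sub_sub_cancel ENNReal.one_ne_top (decay_le_one a)] at this

lemma pow_le_meanReturnTime (w : ℕ → ℝ≥0∞) (a : ℕ) :
    4 ^ a ≤ meanReturnTime (walk w) (site base) (site (cell a 0)) := by
  have ascend (i n : ℕ) (h : n + i = a) : ((a : ℝ≥0∞) + 1)⁻¹ ^ i * (decay a)⁻¹ ≤
      meanReturnTime (walk w) (site base) (site (cell a n)) := by
    induction i generalizing n with
    | zero => simpa [← h] using inv_decay_le_meanReturnTime w n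
    | succ i ih =>
      refine le_trans ?_ (le_add_self.trans (one_add_climb_mul_meanReturnTime_le w a n))
      rw [climb, if_pos (by omega), pow_succ', mul_assoc]
      gcongr
      exact ih (n + 1) (by omega)
  refine le_of_eq_of_le ?_ (ascend a 0 (zero_add a))
  rw [decay, ENNReal.inv_pow, inv_inv, ← mul_pow, mul_left_comm,
    ENNReal.inv_mul_cancel (by positivity) (by finiteness), mul_one]

/-- The launch weights of the adversary. -/
def wildWeight (a : ℕ) : ℝ≥0∞ := 2⁻¹ ^ (a + 1)

/-- The launch weights of the ergodic walk, which make up for the mean return time from the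
tower `a`. -/
def tameWeight (a : ℕ) : ℝ≥0∞ := 2⁻¹ * decay a * wildWeight a

lemma wildWeight_pos (a : ℕ) : 0 < wildWeight a := ENNReal.pow_pos (by simp) _

lemma tameWeight_pos (a : ℕ) : 0 < tameWeight a :=
  ENNReal.mul_pos (ENNReal.mul_pos (by simp) (decay_pos a).ne').ne' (wildWeight_pos a).ne'

lemma tsum_wildWeight : ∑' a, wildWeight a = 1 := by
  simp_rw [wildWeight]
  rw [ENNReal.tsum_geometric_add_one, ENNReal.one_sub_inv_two, inv_inv]
  exact ENNReal.inv_mul_cancel (by simp) (by simp)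

lemma tsum_tameWeight_le : ∑' a, tameWeight a ≤ 2⁻¹ := by
  calc ∑' a, tameWeight a ≤ ∑' a, 2⁻¹ * wildWeight a := by
        gcongr with a
        exact mul_le_mul_left (mul_le_of_le_one_right zero_le (decay_le_one a)) _
    _ = 2⁻¹ := by rw [ENNReal.tsum_mul_left, tsum_wildWeight, mul_one]

lemma tsum_tameWeight_lt_one : ∑' a, tameWeight a < 1 :=
  tsum_tameWeight_le.trans_lt (by norm_num)

instance : IsMarkovKernel (walk wildWeight) := isMarkovKernel_walk _ tsum_wildWeight.le

instance : IsMarkovKernel (walk tameWeight) := isMarkovKernel_walk _ tsum_tameWeight_lt_one.le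

lemma walk_tameWeight_base_pos : 0 < walk tameWeight (site base) {site base} := by
  refine (tsub_pos_of_lt tsum_tameWeight_lt_one).trans_le ?_
  rw [← lintegral_indicator_one .of_discrete, lintegral_walk_base]
  exact le_add_left (by simp)

theorem meanReturnTime_tame_ne_top :
    meanReturnTime (walk tameWeight) (site base) (site base) ≠ ∞ := by
  have balanced (a : ℕ) : tameWeight a * meanBound (cell a 0) = wildWeight a := by
    calc tameWeight a * meanBound (cell a 0)
        = (2⁻¹ * 2) * (decay a * (decay a)⁻¹) * wildWeight a := by
          simp only [tameWeight, meanBound, Nat.cast_zero, zero_add]; ring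
      _ = wildWeight a := by
          rw [ENNReal.mul_inv_cancel (decay_pos a).ne' (decay_ne_top a),
            ENNReal.inv_mul_cancel (by simp) (by simp), one_mul, one_mul]
  refine ne_top_of_le_ne_top ?_ (meanReturnTime_walk_le tameWeight (site base))
  simp only [lintegral_walk_base, Equiv.symm_apply_apply, balanced, tsum_wildWeight]
  simp [meanBound]

theorem meanReturnTime_wild_eq_top :
    meanReturnTime (walk wildWeight) (site base) (site base) = ∞ := by
  have launched (a : ℕ) : wildWeight a * 4 ^ a ≤
      meanReturnTime (walk wildWeight) (site base) (site base) := by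
    calc wildWeight a * 4 ^ a
        ≤ walk wildWeight (site base) {site (cell a 0)} *
            meanReturnTime (walk wildWeight) (site base) (site (cell a 0)) :=
          mul_le_mul' (le_walk_base_apply _ _) (pow_le_meanReturnTime _ _)
      _ ≤ meanReturnTime (walk wildWeight) (site base) (site base) :=
          le_add_self.trans (one_add_mul_meanReturnTime_le (walk wildWeight)
            (site.injective.ne (by simp : cell a 0 ≠ base)) (site base))
  have four_eq : (4 : ℝ≥0∞) = 2 * 2 := by norm_num
  have two_inv : (2⁻¹ * 2 : ℝ≥0∞) = 1 := ENNReal.inv_mul_cancel (by simp) (by simp)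
  refine ENNReal.eq_top_of_forall_nnreal_le fun r => ?_
  obtain ⟨n, hn⟩ := exists_nat_ge r
  calc (r : ℝ≥0∞) ≤ n := by exact_mod_cast hn
    _ ≤ 2 ^ n := by exact_mod_cast Nat.lt_two_pow_self.le
    _ = wildWeight (n + 1) * 4 ^ (n + 1) := by
        rw [wildWeight, four_eq, mul_pow, pow_succ _ (n + 1), mul_mul_mul_comm, ← mul_pow, two_inv,
          one_pow, one_mul, pow_succ', ← mul_assoc, two_inv, one_mul]
    _ ≤ _ := launched (n + 1)

/-- A potential that bounds the mean number of visits to the sites of height at most `N` before the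
walk reaches the base. -/
def visitBound (N : ℕ) : Site → ℕ
  | base => 0
  | cell 0 n => min (n + 1) N
  | cell (_ + 1) n => N + (N - n)

lemma visitBound_below (N n : ℕ) : visitBound N (below n) = min n N := by
  cases n <;> simp [below, visitBound]

/-- The points of the state space of height at most `N`. -/
def lowPart (N : ℕ) : Set towers := {x | (site.symm x).height ≤ N}

lemma indicator_lowPart_cell (N a n : ℕ) : (lowPart N).indicator (1 : towers → ℝ≥0∞)
    (site (cell a n)) = ((if n < N then 1 else 0 : ℕ) : ℝ≥0∞) := by
  simp [lowPart, Set.indicator_apply, height]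

lemma indicator_lowPart_add_lintegral_visitBound_le (w : ℕ → ℝ≥0∞) (N a n : ℕ) :
    (lowPart N).indicator 1 (site (cell a n)) +
      ∫⁻ x, visitBound N (site.symm x) ∂walk w (site (cell a n)) ≤ visitBound N (cell a n) := by
  rw [indicator_lowPart_cell]
  rcases a with _ | a
  · simp only [lintegral_walk_cell, climb_zero, zero_mul, zero_add, tsub_zero, one_mul,
      Equiv.symm_apply_apply, visitBound_below]
    norm_cast
    simp only [visitBound]
    split_ifs <;> omega
  · calc _ ≤ ((if n < N then 1 else 0 : ℕ) : ℝ≥0∞) + (N + (N - (n + 1)) : ℕ) := by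
          gcongr
          refine lintegral_walk_cell_le w ?_ ?_
          · simp [visitBound]
          · simp only [Equiv.symm_apply_apply, visitBound_below]
            exact_mod_cast (min_le_right n N).trans (Nat.le_add_right _ _)
      _ ≤ visitBound N (cell (a + 1) n) := by
          norm_cast
          simp only [visitBound]
          split_ifs <;> omega

lemma lintegral_visitBound_wild_ne_top (N : ℕ) :
    ∫⁻ x, visitBound N (site.symm x) ∂walk wildWeight (site base) ≠ ∞ := by
  have visitBound_le (s : Site) : visitBound N s ≤ 2 * N := by
    rcases s with _ | ⟨_ | a, n⟩ <;> simp only [visitBound] <;> omega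
  refine ne_top_of_le_ne_top (ENNReal.natCast_ne_top (2 * N)) ?_
  calc ∫⁻ x, visitBound N (site.symm x) ∂walk wildWeight (site base)
      ≤ ∫⁻ _, (2 * N : ℕ) ∂walk wildWeight (site base) :=
        lintegral_mono fun x => Nat.cast_le.2 (visitBound_le (site.symm x))
    _ = (2 * N : ℕ) := by simp

theorem exists_wild_pow_dist_le_lt (L : ℝ) :
    ∃ n, (walk wildWeight ^ n) (site base) {y | dist y (site base) ≤ L} < 2⁻¹ := by
  obtain ⟨N, hN⟩ := exists_nat_ge L
  have ball_subset : {y | dist y (site base) ≤ L} ⊆ lowPart N := by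
    refine site.surjective.forall.2 fun s hs => ?_
    have : (s.height : ℝ) ≤ N := by
      simpa [height] using (abs_height_sub_le s base).trans (hs.trans hN)
    simpa [lowPart] using this
  have foster : ∀ z, z ≠ site base → (lowPart N).indicator 1 z +
      ∫⁻ x, visitBound N (site.symm x) ∂walk wildWeight z ≤ visitBound N (site.symm z) := by
    refine site.surjective.forall.2 ?_
    rintro (_ | ⟨a, n⟩) hs
    · exact absurd rfl hs
    · simpa only [Equiv.symm_apply_apply] using
        indicator_lowPart_add_lintegral_visitBound_le wildWeight N a n
  obtain ⟨n, hn⟩ := exists_pow_apply_lt meanReturnTime_wild_eq_top (s := lowPart N) .of_discrete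
    .of_discrete (lintegral_visitBound_wild_ne_top N) foster (c := 2⁻¹) (by simp)
  exact ⟨n, (measure_mono ball_subset).trans_lt hn⟩

theorem isIrreducibleChain_tame : IsIrreducibleChain (walk tameWeight) :=
  isIrreducibleChain_walk tameWeight_pos

/-- The tame tower walk, with an adversary that acts at the base only. -/
def towerSetup : AdversarialSetup towers where
  origin := site base
  P := walk tameWeight
  markov := inferInstance
  statDist := stationaryLaw (walk tameWeight) (site base)
  ergodic := harrisErgodic_stationaryLaw isIrreducibleChain_tame walk_tameWeight_base_pos
    meanReturnTime_tame_ne_top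
  D := 2
  bounded_jumps := walk_dist_le _ tsum_tameWeight_lt_one.le
  K := {site base}
  K_measurable := measurableSet_singleton _
  K_bounded := Bornology.isBounded_singleton
  K_nonempty := Set.singleton_nonempty _
  x₀ := site base
  x₀_mem := rfl

end AdversarialMarkov

end

open AdversarialMarkov

theorem proposition3 :
    ∃ (𝓧 : Set (EuclideanSpace ℝ (Fin 2))) (S : AdversarialMarkov.AdversarialSetup 𝓧)
      (Q : Kernel 𝓧 𝓧) (_ : IsMarkovKernel Q)
      (Ω : Type) (_ : MeasurableSpace Ω) (μ : Measure Ω) (X : ℕ → Ω → 𝓧),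
      𝓧.Countable ∧ IsClosed 𝓧 ∧
      AdversarialMarkov.TVContinuous S.P ∧
      S.IsAdversarialChain μ X ∧
      ¬ S.BoundedInProbability μ X ∧
      -- the adversary is time-homogeneous Markov, its jumps are bounded by `D` as well,
      -- and it turns the positive recurrent `P` into a null recurrent chain
      AdversarialMarkov.IsPositiveRecurrent S.P ∧
      (∀ x, x ∉ S.K → Q x = S.P x) ∧
      (∀ x, Q x {y | dist x y ≤ S.D} = 1) ∧
      AdversarialMarkov.IsMarkovChain Q μ X ∧
      AdversarialMarkov.IsNullRecurrent Q := by
  have wild_eq_tame : ∀ x ∉ towerSetup.K, walk wildWeight x = towerSetup.P x :=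
    fun x hx => walk_eq_of_ne_base _ _ hx
  have wild_jump : ∀ x, walk wildWeight x {y | dist x y ≤ towerSetup.D} = 1 :=
    walk_dist_le _ tsum_wildWeight.le
  exact ⟨towers, towerSetup, walk wildWeight, inferInstance, ℕ → towers, inferInstance,
    chainLaw (walk wildWeight) (site .base), fun n ω => ω n, countable_towers, isClosed_towers,
    tvContinuous_walk tameWeight,
    isAdversarialChain_chainLaw wild_eq_tame wild_jump,
    not_boundedInProbability_chainLaw exists_wild_pow_dist_le_lt,
    isPositiveRecurrent isIrreducibleChain_tame meanReturnTime_tame_ne_top,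
    wild_eq_tame, wild_jump, isMarkovChain_chainLaw _ _,
    isNullRecurrent (isIrreducibleChain_walk wildWeight_pos) (escapeProb_walk_base _)
      meanReturnTime_wild_eq_top⟩
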